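/- Let $Q$ be a probability distribution on $\mathbb{R}$ with expectation $0$, variance $1/2$ and finite fourth moment $b=\int x^4\,dQ(x)$. For $n\ge m$, let $X=X(n,m)$ be an $n\times m$ matrix whose entries are i.i.d. complex random variables whose real and imaginary parts are independent, each with distribution $Q$, and for $\mu,\nu\in\mathbb{C}$ put $$f(n,m;\mu,\nu):=\mathbb{E}\bigl(\det(X^*X-\mu)\,\det(X^*X-\nu)\bigr).$$ Let $\alpha\in\mathbb{N}=\{0,1,2,\dots\}$ be fixed, and let $n:=N$ and $m:=N-\alpha$ for $N\ge\alpha$. For $\mu,\nu\in\mathbb{R}$ set $$Z_N(\mu,\nu):=\bigl(16N^2+4(\mu+\nu)N^{4/3}+\mu\nu N^{2/3}\bigr)^{\alpha/2}\exp\bigl(-4N-\tfrac12(\mu+\nu)N^{1/3}\bigr).$$ Let $\mathrm{Ai}$ be the Airy function, $\mathrm{Ai}(x)=\frac{1}{2\pi i}\int_{1-i\infty}^{1+i\infty}\exp(z^3/3-xz)\,dz$, and let $$\mathbb{A}(x,y):=\frac{\mathrm{Ai}(x)\mathrm{Ai}'(y)-\mathrm{Ai}'(x)\mathrm{Ai}(y)}{x-y}\quad(x\ne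 y),\qquad \mathbb{A}(x,x):=\mathrm{Ai}'(x)^2-x\,\mathrm{Ai}(x)^2$$ be the Airy kernel (the value on the diagonal being the continuous extension). Theorem 5.1. For all $\mu,\nu\in\mathbb{R}$, $$\lim_{N\to\infty}\left(2^{4/3}N^{1/3}\,Z_N(2^{4/3}\mu,2^{4/3}\nu)\cdot\frac{f\bigl(n,m;\,4N+2^{4/3}\mu N^{1/3},\,4N+2^{4/3}\nu N^{1/3}\bigr)}{n!\,m!}\right)=\exp(b^*)\,\mathbb{A}(\mu,\nu),\qquad b^*:=2\bigl(b-\tfrac34\bigr).$$ -/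

import Mathlib

open MeasureTheory ProbabilityTheory Filter Topology
open scoped Matrix Nat

noncomputable section

/-- The law on `ℂ` of a random variable whose real and imaginary parts are independent,
each with distribution `Q`. -/
def complexEntryLaw (Q : Measure ℝ) : Measure ℂ :=
  (Q.prod Q).map (fun p : ℝ × ℝ => (⟨p.1, p.2⟩ : ℂ))

/-- The joint law of the `n * m` entries of an `n × m` matrix with i.i.d. entries, each with
law `complexEntryLaw Q`. -/
def complexMatrixLaw (Q : Measure ℝ) (n m : ℕ) : Measure (Fin n × Fin m → ℂ) :=
  Measure.pi (fun _ => complexEntryLaw Q)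

/-- The second-order correlation function of the characteristic polynomial of the unrescaled
complex sample covariance matrix:
`f(n, m; μ, ν) = 𝔼 (det (X* X - μ) det (X* X - ν))`, where `X` is an `n × m` matrix with
i.i.d. complex entries whose real and imaginary parts are independent with distribution `Q`. -/
def secondOrderCorrelation (Q : Measure ℝ) (n m : ℕ) (μ ν : ℂ) : ℂ :=
  ∫ x : Fin n × Fin m → ℂ,
    (let X : Matrix (Fin n) (Fin m) ℂ := Matrix.of fun i j => x (i, j)
     (Xᴴ * X - μ • (1 : Matrix (Fin m) (Fin m) ℂ)).det *
      (Xᴴ * X - ν • (1 : Matrix (Fin m) (Fin m) ℂ)).det)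
    ∂(complexMatrixLaw Q n m)

/-- The Airy function `Ai` on the real line, by its contour integral
`Ai x = (1 / (2 π i)) ∫ exp (z ^ 3 / 3 - x z) dz` over the upward vertical line `Re z = 1`,
parametrized by `z = 1 + i t`. The integrand decays like `exp (- t ^ 2)`, so the integral
converges absolutely; its value is real. -/
def airyAi (x : ℝ) : ℝ :=
  (1 / (2 * Real.pi)) *
    (∫ t : ℝ, Complex.exp ((1 + t * Complex.I) ^ 3 / 3 - x * (1 + t * Complex.I))).re

/-- The Airy kernel `(Ai x Ai' y - Ai' x Ai y) / (x - y)`, on the diagonal extended by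
continuity, with value `Ai' x ^ 2 - x Ai x ^ 2` (recall `Ai'' x = x Ai x`). -/
def airyKernel (x y : ℝ) : ℝ :=
  if x = y then deriv airyAi x ^ 2 - x * airyAi x ^ 2
  else (airyAi x * deriv airyAi y - deriv airyAi x * airyAi y) / (x - y)

/-- The scaling factor `Z_N(μ, ν)` at the soft edge. -/
def softEdgeScaling (α N : ℕ) (μ ν : ℝ) : ℝ :=
  (16 * (N : ℝ) ^ 2 + 4 * (μ + ν) * (N : ℝ) ^ (4 / 3 : ℝ) + μ * ν * (N : ℝ) ^ (2 / 3 : ℝ)) ^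
      ((α : ℝ) / 2) *
    Real.exp (-4 * (N : ℝ) - (1 / 2) * (μ + ν) * (N : ℝ) ^ (1 / 3 : ℝ))

end

/-! Write `p` for the characteristic polynomial of `X* X` and `κ = 2(b - 3/4)`. The argument is an
exact finite-size formula followed by a saddle point analysis.

Exact formula. The proof computes the expectation of the skew form `Φ(X p) Ψ(p) - Φ(p) Ψ(X p)` for
arbitrary linear functionals; for the evaluations at `x` and `y` it is `(x - y) p(x) p(y)`. A new
row of the matrix is a rank-one perturbation of the Gram matrix, so the new `p` is the old one plus
a Hermitian form in the row, whose coefficients are adjugate entries of the characteristic matrix.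
Averaging over the row uses only moments up to order four. The Gaussian part of the average contains
a double sum over adjugate entries, but in the skew combination this sum collapses to `p` and `p'`
(`sum_adjugate_charmatrix_skew`), and what remains is the substitution of `1 - d/dX` in both
functionals. The non-Gaussian part is `κ` times a sum over diagonal adjugate entries, which are the
same polynomials for matrices with one column fewer. The recursion is thus closed, and
`IsStandardEntry.integral_skewForm` solves it in terms of the Laguerre polynomials `(1 - d/dX)^n
X^m`. A Christoffel-Darboux formula along the diagonal (`laguerreSkew_eval`) divides out `x - y`,
giving `f / (n! m!) = ∑_d κ^d / d! ∑_{k ≥ d} L_{n-k,m-k}(x) L_{n-k,m-k}(y) / ((n-k)! (m-k)!)`.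

Asymptotics. `L_{n,m}(x) / m!` is the coefficient of `t^m` in `(1 - t)^n e^{xt}`. With `ε =
(2N)^{-1/3}`, the Cauchy integral over the circle of radius `e^{-ε}/2`, parametrized by `t =
e^{-s}/2` with `s = ε(1 + iu)`, has phase `log(2e^s - 1) + 2(e^{-s} - 1) ~ (2/3) s^3`: the double
saddle is at `t = 1/2`, and the line `Re z = 1` of the Airy integral appears for `z = s/ε`. Lowering
the indices by `k` shifts the Airy argument by `2εk` and gains a factor `e^{-εk}` in the bounds. The
sum over `k` is therefore a dominated Riemann sum of mesh `2ε` for `∫_0^∞ Ai(μ+s) Ai(ν+s) ds`, which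
is the Airy kernel (`integral_airyAi_mul_airyAi`). For each fixed `d` the missing first `d` terms
are negligible, so the outer sum contributes `∑ κ^d / d! = e^κ` (`tendsto_exp_weighted_tails`). -/

/-! ### Rank-one updates and adjugates of characteristic matrices -/

/-- The matrix determinant lemma for a rank-one update, in terms of the adjugate. -/
theorem det_add_vecMulVec_of_det_ne_zero {R : Type*} [CommRing R] [IsDomain R] {m : ℕ}
    (A : Matrix (Fin m) (Fin m) R) (hA : A.det ≠ 0) (u v : Fin m → R) :
    (A + Matrix.vecMulVec u v).det = A.det + ∑ i, ∑ j, u i * v j * A.adjugate j i := by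
  -- Over the fraction field `A` is invertible and its adjugate is `det A` times the inverse.
  let K := FractionRing R
  let f : R →+* K := algebraMap R K
  have hf : Function.Injective f := IsFractionRing.injective R K
  apply hf
  have hdet : IsUnit (f.mapMatrix A).det := by
    rw [← RingHom.map_det]
    exact isUnit_iff_ne_zero.mpr fun h => hA (hf (by rw [h, map_zero]))
  have h := Matrix.det_add_replicateCol_mul_replicateRow (ι := Unit) hdet (f ∘ u) (f ∘ v)
  have e : f.mapMatrix (A + Matrix.vecMulVec u v) = f.mapMatrix A +
      Matrix.replicateCol Unit (f ∘ u) * Matrix.replicateRow Unit (f ∘ v) := by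
    ext i j
    simp [Matrix.vecMulVec_apply, Matrix.mul_apply]
  rw [RingHom.map_det, e, h, Matrix.det_unique (1 + _ * _ * _), Matrix.add_apply,
    Matrix.one_apply_eq, mul_add, mul_one, ← RingHom.map_det, map_add]
  congr 1
  have hne : f A.det ≠ 0 := by
    rw [RingHom.map_det]; exact hdet.ne_zero
  rw [Matrix.inv_def, ← RingHom.map_det, Ring.inverse_eq_inv', Matrix.mul_smul, Matrix.smul_mul,
    Matrix.smul_apply, smul_eq_mul, mul_inv_cancel_left₀ hne, ← RingHom.map_adjugate]
  simp only [Matrix.mul_apply, Matrix.replicateRow_apply, Matrix.replicateCol_apply,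
    RingHom.mapMatrix_apply, Matrix.map_apply, Function.comp, map_sum, map_mul, Finset.sum_mul]
  refine Finset.sum_congr rfl fun i _ => Finset.sum_congr rfl fun j _ => by ring

open Polynomial in
/-- The derivative of a characteristic polynomial is the trace of the adjugate. -/
theorem derivative_charpoly_eq_trace_adjugate {R : Type*} [CommRing R] {m : ℕ}
    (W : Matrix (Fin m) (Fin m) R) :
    derivative W.charpoly = ∑ i, W.charmatrix.adjugate i i := by
  -- The derivative of entry `(σ i, i)` of the characteristic matrix is a Kronecker delta, which is
  -- also the entry of the unit column that defines the adjugate. The Leibniz expansions then agree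
  -- term by term.
  have key : ∀ i, W.charmatrix.adjugate i i = ∑ σ : Equiv.Perm (Fin m),
      (Equiv.Perm.sign σ : ℤ) • ((∏ b ∈ Finset.univ.erase i, W.charmatrix (σ b) b) *
        derivative (W.charmatrix (σ i) i)) := by
    intro i
    rw [← Matrix.transpose_apply W.charmatrix.adjugate i i, Matrix.adjugate_transpose,
      Matrix.adjugate_apply, Matrix.updateRow_transpose, Matrix.det_transpose, Matrix.det_apply]
    refine Finset.sum_congr rfl fun σ _ => ?_
    rw [← Finset.prod_erase_mul _ _ (Finset.mem_univ i)]
    congr 2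
    · refine Finset.prod_congr rfl fun b hb => ?_
      rw [Matrix.updateCol_ne (Finset.ne_of_mem_erase hb)]
    · rw [Matrix.updateCol_self, Matrix.charmatrix_apply, Matrix.diagonal_apply]
      by_cases h : σ i = i <;> simp [h]
  rw [Matrix.charpoly, Matrix.det_apply, derivative_sum]
  simp_rw [key]
  rw [Finset.sum_comm]
  refine Finset.sum_congr rfl fun σ _ => ?_
  rw [← Finset.smul_sum, ← derivative_prod_finset]
  simp [Units.smul_def]

open Polynomial in
/-- The bilinear form `(p, r) ↦ Φ (X p) Ψ r - Φ p Ψ (X r)`, evaluated on the entries of the adjugate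
of a characteristic matrix. -/
theorem sum_adjugate_charmatrix_skew {m : ℕ} (W : Matrix (Fin m) (Fin m) ℂ) (Φ Ψ : ℂ[X] →ₗ[ℂ] ℂ) :
    ∑ i, ∑ j, (Φ (X * W.charmatrix.adjugate i j) * Ψ (W.charmatrix.adjugate j i) -
        Φ (W.charmatrix.adjugate i j) * Ψ (X * W.charmatrix.adjugate j i)) =
      Φ W.charpoly * Ψ (derivative W.charpoly) - Φ (derivative W.charpoly) * Ψ W.charpoly := by
  set B := W.charmatrix.adjugate with hB
  -- `h1` and `h2` read off `X B = W B + p` and `X B = B W + p` from the two adjugate identities.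
  -- One is used under `Φ`, the other under `Ψ`.
  have h1 : ∀ i j, X * B i j = ∑ k, W i k • B k j + if i = j then W.charpoly else 0 := by
    intro i j
    have := congrFun (congrFun (Matrix.mul_adjugate W.charmatrix) i) j
    rw [Matrix.charmatrix, Matrix.sub_mul, Matrix.sub_apply, ← Matrix.charmatrix, ← hB,
      Matrix.scalar_apply, Matrix.diagonal_mul] at this
    simp only [Matrix.smul_apply, Matrix.one_apply,
      smul_eq_mul, mul_ite, mul_one, mul_zero, Matrix.mul_apply, RingHom.mapMatrix_apply,
      Matrix.map_apply] at this
    rw [sub_eq_iff_eq_add] at this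
    rw [this, add_comm]
    simp [Matrix.charpoly, Algebra.smul_def]
  have h2 : ∀ i j, X * B i j = ∑ k, W k j • B i k + if i = j then W.charpoly else 0 := by
    intro i j
    have := congrFun (congrFun (Matrix.adjugate_mul W.charmatrix) i) j
    rw [Matrix.charmatrix, Matrix.mul_sub, Matrix.sub_apply, ← Matrix.charmatrix, ← hB,
      Matrix.scalar_apply, Matrix.mul_diagonal] at this
    simp only [Matrix.smul_apply, Matrix.one_apply,
      smul_eq_mul, mul_ite, mul_one, mul_zero, Matrix.mul_apply, RingHom.mapMatrix_apply,
      Matrix.map_apply] at this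
    rw [sub_eq_iff_eq_add] at this
    rw [mul_comm, this, add_comm]
    simp [Matrix.charpoly, Algebra.smul_def, mul_comm]
  have h3 : ∑ i, ∑ j, Φ (X * B i j) * Ψ (B j i) =
      ∑ i, ∑ j, ∑ k, W i k * (Φ (B k j) * Ψ (B j i)) + Φ W.charpoly * Ψ (∑ i, B i i) := by
    rw [map_sum, Finset.mul_sum, ← Finset.sum_add_distrib]
    refine Finset.sum_congr rfl fun i _ => ?_
    have : Φ W.charpoly * Ψ (B i i) = ∑ j, (if i = j then Φ W.charpoly else 0) * Ψ (B j i) := by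
      simp
    rw [this, ← Finset.sum_add_distrib]
    refine Finset.sum_congr rfl fun j _ => ?_
    rw [h1, map_add, map_sum, add_mul, Finset.sum_mul, apply_ite Φ, map_zero]
    simp [mul_assoc]
  have h4 : ∑ i, ∑ j, Φ (B i j) * Ψ (X * B j i) =
      ∑ i, ∑ j, ∑ k, W k i * (Φ (B i j) * Ψ (B j k)) + Φ (∑ i, B i i) * Ψ W.charpoly := by
    rw [map_sum, Finset.sum_mul, ← Finset.sum_add_distrib]
    refine Finset.sum_congr rfl fun i _ => ?_
    have : Φ (B i i) * Ψ W.charpoly = ∑ j, Φ (B i j) * (if j = i then Ψ W.charpoly else 0) := by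
      simp
    rw [this, ← Finset.sum_add_distrib]
    refine Finset.sum_congr rfl fun j _ => ?_
    rw [h2 j i, map_add, map_sum, mul_add, Finset.mul_sum, apply_ite Ψ, map_zero]
    congr 1
    refine Finset.sum_congr rfl fun k _ => ?_
    simp; ring
  -- Cyclicity of the trace: the two terms containing `W` coincide and cancel in the difference.
  have h5 : ∑ i, ∑ j, ∑ k, W i k * (Φ (B k j) * Ψ (B j i)) =
      ∑ i, ∑ j, ∑ k, W k i * (Φ (B i j) * Ψ (B j k)) := by
    rw [Finset.sum_comm]
    conv_rhs => rw [Finset.sum_comm]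
    refine Finset.sum_congr rfl fun j _ => ?_
    rw [Finset.sum_comm]
  simp_rw [Finset.sum_sub_distrib]
  rw [h3, h4, h5, derivative_charpoly_eq_trace_adjugate]
  ring

/-! ### Entry moments and averages of Hermitian forms -/

open scoped ComplexConjugate in
/-- The mixed moment `𝔼 (conj z ^ p * z ^ q)` of a law on `ℂ`. -/
noncomputable def mixedMoment (ρ : Measure ℂ) (p q : ℕ) : ℂ := ∫ z, conj z ^ p * z ^ q ∂ρ

/-- The moments of a matrix entry up to order four that enter the second-order correlation
function: the entry is centered, has the second moments of a standard complex Gaussian, and its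
fourth absolute moment exceeds the Gaussian one by `κ`. -/
structure IsStandardEntry (ρ : Measure ℂ) (κ : ℂ) : Prop where
  integrable : Integrable (fun z : ℂ => (1 + ‖z‖) ^ 4) ρ
  moment_one_zero : mixedMoment ρ 1 0 = 0
  moment_zero_one : mixedMoment ρ 0 1 = 0
  moment_two_zero : mixedMoment ρ 2 0 = 0
  moment_zero_two : mixedMoment ρ 0 2 = 0
  moment_one_one : mixedMoment ρ 1 1 = 1
  moment_two_two : mixedMoment ρ 2 2 = 2 + κ

theorem mixedMoment_zero_zero (ρ : Measure ℂ) [IsProbabilityMeasure ρ] :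
    mixedMoment ρ 0 0 = 1 := by simp [mixedMoment]

section Moments

variable {ρ : Measure ℂ} [IsProbabilityMeasure ρ] {κ : ℂ} {m : ℕ}

open scoped ComplexConjugate

theorem IsStandardEntry.integrable_monomial (h : IsStandardEntry ρ κ) (p q : Fin m → ℕ)
    (hp : ∀ a, p a ≤ 2) (hq : ∀ a, q a ≤ 2) :
    Integrable (fun v : Fin m → ℂ => ∏ a, (conj (v a) ^ p a * v a ^ q a))
      (Measure.pi fun _ => ρ) := by
  refine Integrable.fintype_prod (f := fun a (z : ℂ) => conj z ^ p a * z ^ q a) fun a => ?_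
  refine h.integrable.mono' (by fun_prop) (ae_of_all _ fun z => ?_)
  rw [norm_mul, norm_pow, norm_pow, RCLike.norm_conj, ← pow_add]
  calc ‖z‖ ^ (p a + q a) ≤ (1 + ‖z‖) ^ (p a + q a) := by
        gcongr; linarith
    _ ≤ (1 + ‖z‖) ^ 4 := pow_le_pow_right₀ (by linarith [norm_nonneg z])
        (by have := hp a; have := hq a; omega)

theorem integral_monomial (p q : Fin m → ℕ) :
    ∫ v : Fin m → ℂ, ∏ a, (conj (v a) ^ p a * v a ^ q a) ∂(Measure.pi fun _ => ρ) =
      ∏ a, mixedMoment ρ (p a) (q a) :=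
  integral_fintype_prod_eq_prod (fun a (z : ℂ) => conj z ^ p a * z ^ q a)

/-- The exponent vector of the coordinate `i`. -/
def unitExponent (i a : Fin m) : ℕ := if a = i then 1 else 0

theorem prod_pow_unitExponent (v : Fin m → ℂ) (i : Fin m) : ∏ a, v a ^ unitExponent i a = v i := by
  simp [unitExponent, pow_ite]

theorem two_monomial_eq (v : Fin m → ℂ) (i j : Fin m) :
    conj (v i) * v j = ∏ a, (conj (v a) ^ unitExponent i a * v a ^ unitExponent j a) := by
  rw [Finset.prod_mul_distrib, prod_pow_unitExponent (fun a => conj (v a)),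
    prod_pow_unitExponent]

theorem four_monomial_eq (v : Fin m → ℂ) (i j k l : Fin m) :
    conj (v i) * v j * (conj (v k) * v l) =
      ∏ a, (conj (v a) ^ (unitExponent i a + unitExponent k a) *
        v a ^ (unitExponent j a + unitExponent l a)) := by
  simp_rw [pow_add, Finset.prod_mul_distrib, prod_pow_unitExponent]
  ring

theorem IsStandardEntry.integrable_two (h : IsStandardEntry ρ κ) (i j : Fin m) :
    Integrable (fun v : Fin m → ℂ => conj (v i) * v j) (Measure.pi fun _ => ρ) := by
  simp_rw [two_monomial_eq]
  refine h.integrable_monomial _ _ (fun a => ?_) fun a => ?_ <;>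
  · simp only [unitExponent]; split_ifs <;> omega

theorem IsStandardEntry.integrable_four (h : IsStandardEntry ρ κ) (i j k l : Fin m) :
    Integrable (fun v : Fin m → ℂ => conj (v i) * v j * (conj (v k) * v l))
      (Measure.pi fun _ => ρ) := by
  simp_rw [four_monomial_eq]
  refine h.integrable_monomial _ _ (fun a => ?_) fun a => ?_ <;>
  · simp only [unitExponent]; split_ifs <;> omega

theorem IsStandardEntry.integral_two (h : IsStandardEntry ρ κ) (i j : Fin m) :
    ∫ v : Fin m → ℂ, conj (v i) * v j ∂(Measure.pi fun _ => ρ) = if i = j then 1 else 0 := by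
  simp_rw [two_monomial_eq]
  rw [integral_monomial]
  split_ifs with hij
  · subst hij
    refine Finset.prod_eq_one fun a _ => ?_
    by_cases ha : a = i <;> simp [unitExponent, ha, h.moment_one_one, mixedMoment_zero_zero]
  · refine Finset.prod_eq_zero (Finset.mem_univ i) ?_
    simp [unitExponent, hij, h.moment_one_zero]

/-- Wick's formula with a fourth-cumulant correction: two pairings as for a complex Gaussian, plus
`κ` when all indices agree. Third moments never matter, because a coordinate occurring three times
leaves the fourth factor alone, with mean zero. -/
theorem IsStandardEntry.integral_four (h : IsStandardEntry ρ κ) (i j k l : Fin m) :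
    ∫ v : Fin m → ℂ, conj (v i) * v j * (conj (v k) * v l) ∂(Measure.pi fun _ => ρ) =
      (if i = j then if k = l then 1 else 0 else 0) + (if i = l then if k = j then 1 else 0 else 0)
        + if i = j then if k = l then if i = k then κ else 0 else 0 else 0 := by
  simp_rw [four_monomial_eq]
  rw [integral_monomial]
  by_cases hik : i = k
  · subst hik
    by_cases hij : i = j
    · subst hij
      by_cases hil : i = l
      · subst hil
        rw [Finset.prod_eq_single i]
        · simp [unitExponent, h.moment_two_two]; ring
        · intro a _ ha
          simp [unitExponent, ha, mixedMoment_zero_zero]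
        · simp
      · simp only [hil, if_true, if_false]
        rw [Finset.prod_eq_zero (Finset.mem_univ l)] <;>
        simp [unitExponent, Ne.symm hil, h.moment_zero_one]
    · by_cases hjl : j = l
      · subst hjl
        rw [Finset.prod_eq_zero (Finset.mem_univ i)] <;>
        simp [unitExponent, hij, h.moment_two_zero]
      · rw [Finset.prod_eq_zero (Finset.mem_univ j)] <;>
        simp [unitExponent, hij, Ne.symm hij, hjl, h.moment_zero_one]
  · have hki : ¬ k = i := fun e => hik e.symm
    by_cases hij : i = j
    · subst hij
      by_cases hkl : k = l
      · subst hkl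
        rw [Finset.prod_eq_one]
        · simp [hik]
        · intro a _
          by_cases hai : a = i
          · subst hai; simp [unitExponent, hik, h.moment_one_one]
          · by_cases hak : a = k
            · subst hak; simp [unitExponent, hki, h.moment_one_one]
            · simp [unitExponent, hai, hak, mixedMoment_zero_zero]
      · rw [Finset.prod_eq_zero (Finset.mem_univ k)] <;>
        simp [unitExponent, hkl, hki, h.moment_one_zero]
    · by_cases hil : i = l
      · subst hil
        by_cases hkj : k = j
        · subst hkj
          rw [Finset.prod_eq_one]
          · simp [hik]
          · intro a _
            by_cases hai : a = i
            · subst hai; simp [unitExponent, hik, h.moment_one_one]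
            · by_cases hak : a = k
              · subst hak; simp [unitExponent, hki, h.moment_one_one]
              · simp [unitExponent, hai, hak, mixedMoment_zero_zero]
        · rw [Finset.prod_eq_zero (Finset.mem_univ k)] <;>
          simp [unitExponent, hkj, hki, hij, h.moment_one_zero]
      · rw [Finset.prod_eq_zero (Finset.mem_univ i)] <;>
        simp [unitExponent, hil, hik, hij, h.moment_one_zero]

theorem quadratic_mul_quadratic (A B : Matrix (Fin m) (Fin m) ℂ) (a b : ℂ) (v : Fin m → ℂ) :
    (a + ∑ i, ∑ j, conj (v i) * v j * A i j) * (b + ∑ i, ∑ j, conj (v i) * v j * B i j) =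
      (a * b + ∑ i, ∑ j, conj (v i) * v j * (a * B i j)) +
      ((∑ i, ∑ j, conj (v i) * v j * (b * A i j)) +
      ∑ i, ∑ j, ∑ k, ∑ l, conj (v i) * v j * (conj (v k) * v l) * (A i j * B k l)) := by
  have h1 : ∑ i, ∑ j, conj (v i) * v j * (a * B i j) =
      a * ∑ i, ∑ j, conj (v i) * v j * B i j := by
    simp_rw [Finset.mul_sum]
    exact Finset.sum_congr rfl fun i _ => Finset.sum_congr rfl fun j _ => by ring
  have h2 : ∑ i, ∑ j, conj (v i) * v j * (b * A i j) =
      b * ∑ i, ∑ j, conj (v i) * v j * A i j := by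
    simp_rw [Finset.mul_sum]
    exact Finset.sum_congr rfl fun i _ => Finset.sum_congr rfl fun j _ => by ring
  have h3 : ∑ i, ∑ j, ∑ k, ∑ l, conj (v i) * v j * (conj (v k) * v l) * (A i j * B k l) =
      (∑ i, ∑ j, conj (v i) * v j * A i j) * ∑ i, ∑ j, conj (v i) * v j * B i j := by
    simp_rw [Finset.sum_mul, Finset.mul_sum]
    exact Finset.sum_congr rfl fun i _ => Finset.sum_congr rfl fun j _ =>
      Finset.sum_congr rfl fun k _ => Finset.sum_congr rfl fun l _ => by ring
  rw [h1, h2, h3]; ring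

theorem IsStandardEntry.integrable_linear (h : IsStandardEntry ρ κ) (c : Fin m → Fin m → ℂ) :
    Integrable (fun v : Fin m → ℂ => ∑ i, ∑ j, conj (v i) * v j * c i j)
      (Measure.pi fun _ => ρ) :=
  integrable_finsetSum _ fun i _ => integrable_finsetSum _ fun j _ =>
    (h.integrable_two i j).mul_const _

theorem IsStandardEntry.integrable_quadratic (h : IsStandardEntry ρ κ)
    (A B : Matrix (Fin m) (Fin m) ℂ) (a b : ℂ) :
    Integrable (fun v : Fin m → ℂ => (a + ∑ i, ∑ j, conj (v i) * v j * A i j) *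
        (b + ∑ i, ∑ j, conj (v i) * v j * B i j)) (Measure.pi fun _ => ρ) := by
  simp_rw [quadratic_mul_quadratic]
  refine ((integrable_const _).add (h.integrable_linear _)).add ((h.integrable_linear _).add ?_)
  exact integrable_finsetSum _ fun i _ => integrable_finsetSum _ fun j _ =>
    integrable_finsetSum _ fun k _ => integrable_finsetSum _ fun l _ =>
      (h.integrable_four i j k l).mul_const _

/-- The expected product of two inhomogeneous Hermitian forms in a vector of independent standard
entries. -/
theorem IsStandardEntry.integral_quadratic (h : IsStandardEntry ρ κ)
    (A B : Matrix (Fin m) (Fin m) ℂ) (a b : ℂ) :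
    ∫ v : Fin m → ℂ, (a + ∑ i, ∑ j, conj (v i) * v j * A i j) *
        (b + ∑ i, ∑ j, conj (v i) * v j * B i j) ∂(Measure.pi fun _ => ρ) =
      (a + ∑ i, A i i) * (b + ∑ i, B i i) + ∑ i, ∑ j, A i j * B j i + κ * ∑ i, A i i * B i i := by
  have v2 : ∀ (c : Fin m → Fin m → ℂ), ∫ v : Fin m → ℂ,
      ∑ i, ∑ j, conj (v i) * v j * c i j ∂(Measure.pi fun _ => ρ) = ∑ i, c i i := by
    intro c
    rw [integral_finsetSum _ fun i _ => integrable_finsetSum _ fun j _ =>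
      (h.integrable_two i j).mul_const _]
    refine Finset.sum_congr rfl fun i _ => ?_
    rw [integral_finsetSum _ fun j _ => (h.integrable_two i j).mul_const _]
    simp_rw [integral_mul_const, h.integral_two]
    simp
  have i4 : ∀ i j k l, Integrable (fun v : Fin m → ℂ =>
      conj (v i) * v j * (conj (v k) * v l) * (A i j * B k l)) (Measure.pi fun _ => ρ) :=
    fun i j k l => (h.integrable_four i j k l).mul_const _
  simp_rw [quadratic_mul_quadratic]
  have i1 : Integrable (fun v : Fin m → ℂ => a * b + ∑ i, ∑ j, conj (v i) * v j * (a * B i j))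
      (Measure.pi fun _ => ρ) := (integrable_const _).add (h.integrable_linear _)
  have i5 : ∀ i, Integrable (fun v : Fin m → ℂ => ∑ j, ∑ k, ∑ l,
      conj (v i) * v j * (conj (v k) * v l) * (A i j * B k l)) (Measure.pi fun _ => ρ) :=
    fun i => integrable_finsetSum _ fun j _ => integrable_finsetSum _ fun k _ =>
      integrable_finsetSum _ fun l _ => i4 i j k l
  have i6 : Integrable (fun v : Fin m → ℂ => ∑ i, ∑ j, ∑ k, ∑ l,
      conj (v i) * v j * (conj (v k) * v l) * (A i j * B k l)) (Measure.pi fun _ => ρ) :=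
    integrable_finsetSum _ fun i _ => i5 i
  have i7 : Integrable (fun v : Fin m → ℂ => (∑ i, ∑ j, conj (v i) * v j * (b * A i j)) +
      ∑ i, ∑ j, ∑ k, ∑ l, conj (v i) * v j * (conj (v k) * v l) * (A i j * B k l))
      (Measure.pi fun _ => ρ) := (h.integrable_linear _).add i6
  rw [integral_add i1 i7, integral_add (integrable_const _) (h.integrable_linear _),
    integral_add (h.integrable_linear _) i6, v2, v2, integral_finsetSum _ fun i _ => i5 i]
  have v4 : ∀ i, ∫ v : Fin m → ℂ, ∑ j, ∑ k, ∑ l,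
      conj (v i) * v j * (conj (v k) * v l) * (A i j * B k l) ∂(Measure.pi fun _ => ρ) =
      A i i * (∑ k, B k k) + ∑ j, A i j * B j i + κ * (A i i * B i i) := by
    intro i
    rw [integral_finsetSum _ fun j _ =>
      integrable_finsetSum _ fun k _ => integrable_finsetSum _ fun l _ => i4 i j k l]
    have : ∀ j, ∫ v : Fin m → ℂ, ∑ k, ∑ l,
        conj (v i) * v j * (conj (v k) * v l) * (A i j * B k l) ∂(Measure.pi fun _ => ρ) =
        (if i = j then A i j * ∑ k, B k k else 0) + A i j * B j i +
          if i = j then κ * (A i j * B i i) else 0 := by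
      intro j
      rw [integral_finsetSum _ fun k _ => integrable_finsetSum _ fun l _ => i4 i j k l]
      simp_rw [integral_finsetSum _ fun l _ => i4 i j _ l, integral_mul_const, h.integral_four,
        add_mul, Finset.sum_add_distrib]
      congr 1
      · congr 1
        · split_ifs
          · simp [Finset.mul_sum]
          · simp
        · simp
      · split_ifs
        · simp
        · simp
    simp_rw [this, Finset.sum_add_distrib]
    simp
  simp_rw [v4, Finset.sum_add_distrib, ← Finset.sum_mul, ← Finset.mul_sum]
  simp
  ring

end Moments

/-! ### Gram matrices, row and column removal, integrability -/

section

open Polynomial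

section Gram

variable {n m : ℕ}

/-- The Gram matrix `X* X` of the columns of `X`. -/
noncomputable def gramMatrix (X : Fin n → Fin m → ℂ) : Matrix (Fin m) (Fin m) ℂ :=
  (Matrix.of X)ᴴ * Matrix.of X

/-- The characteristic polynomial of `X* X`. -/
noncomputable def gramPoly (X : Fin n → Fin m → ℂ) : ℂ[X] := (gramMatrix X).charpoly

theorem gramMatrix_apply (X : Fin n → Fin m → ℂ) (a b : Fin m) :
    gramMatrix X a b = ∑ i, star (X i a) * X i b := by
  simp [gramMatrix, Matrix.mul_apply]

theorem gramMatrix_cons (v : Fin m → ℂ) (X : Fin n → Fin m → ℂ) :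
    gramMatrix (Fin.cons v X : Fin (n + 1) → Fin m → ℂ) =
      gramMatrix X + Matrix.vecMulVec (star v) v := by
  ext a b
  simp [gramMatrix_apply, Fin.sum_univ_succ, Matrix.vecMulVec_apply, add_comm]

-- A new row perturbs the Gram matrix by rank one, so the determinant lemma makes the characteristic
-- polynomial an inhomogeneous Hermitian form in that row.
open scoped ComplexConjugate in
theorem gramPoly_cons (v : Fin m → ℂ) (X : Fin n → Fin m → ℂ) :
    gramPoly (Fin.cons v X : Fin (n + 1) → Fin m → ℂ) = gramPoly X +
      ∑ i, ∑ j, (conj (v i) * v j) • (-(gramMatrix X).charmatrix.adjugate j i) := by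
  have e : (gramMatrix (Fin.cons v X : Fin (n + 1) → Fin m → ℂ)).charmatrix =
      (gramMatrix X).charmatrix + Matrix.vecMulVec (fun i => -C (conj (v i))) fun j => C (v j) := by
    rw [gramMatrix_cons]
    ext1 a b
    simp [Matrix.charmatrix_apply, Matrix.vecMulVec_apply]
    ring
  rw [gramPoly, Matrix.charpoly, e, det_add_vecMulVec_of_det_ne_zero]
  · congr 1
    refine Finset.sum_congr rfl fun i _ => Finset.sum_congr rfl fun j _ => ?_
    rw [smul_eq_C_mul, C_mul]; ring
  · exact (Matrix.charpoly_monic _).ne_zero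

/-- The matrix `X` without its column `k`. -/
def dropColumn (k : Fin (m + 1)) (X : Fin n → Fin (m + 1) → ℂ) : Fin n → Fin m → ℂ :=
  fun i j => X i (k.succAbove j)

/-- A principal submatrix of a Gram matrix is the Gram matrix of the remaining columns. This closes
the recursion: the terms carrying `κ` are of the same kind with one column fewer. -/
theorem adjugate_charmatrix_gramMatrix_self (k : Fin (m + 1)) (X : Fin n → Fin (m + 1) → ℂ) :
    (gramMatrix X).charmatrix.adjugate k k = gramPoly (dropColumn k X) := by
  rw [Matrix.adjugate_fin_succ_eq_det_submatrix, ← two_mul, pow_mul, neg_one_sq, one_pow, one_mul,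
    gramPoly, Matrix.charpoly]
  congr 1
  ext1 a b
  simp [Matrix.charmatrix_apply, Matrix.diagonal_apply, gramMatrix_apply, dropColumn]

/-- A function of a matrix is entrywise at most quadratic if it is continuous and of order at most
`∏ (1 + ‖X i j‖) ^ 2`. -/
def IsEntrywiseQuadratic (F : (Fin n → Fin m → ℂ) → ℂ) : Prop :=
  Continuous F ∧ ∃ c, ∀ X, ‖F X‖ ≤ c * ∏ i, ∏ j, (1 + ‖X i j‖) ^ 2

theorem IsEntrywiseQuadratic.mul_const {F : (Fin n → Fin m → ℂ) → ℂ} (hF : IsEntrywiseQuadratic F)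
    (c : ℂ) : IsEntrywiseQuadratic fun X => F X * c := by
  obtain ⟨hc, K, hK⟩ := hF
  refine ⟨by fun_prop, K * ‖c‖, fun X => ?_⟩
  rw [norm_mul, mul_right_comm]
  exact mul_le_mul_of_nonneg_right (hK X) (norm_nonneg _)

theorem IsEntrywiseQuadratic.sum {ι : Type*} (s : Finset ι) {F : ι → (Fin n → Fin m → ℂ) → ℂ}
    (hF : ∀ i, IsEntrywiseQuadratic (F i)) : IsEntrywiseQuadratic fun X => ∑ i ∈ s, F i X := by
  choose hc K hK using hF
  refine ⟨by fun_prop, ∑ i ∈ s, K i, fun X => ?_⟩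
  rw [Finset.sum_mul]
  exact (norm_sum_le _ _).trans (Finset.sum_le_sum fun i _ => hK i X)

/-- Entry `(a, b)` of the matrix is at most a constant times `w a * w b`, where `w a` is the product
of `1 + ‖X i a‖` over the rows. Every Leibniz term meets each index once as a row and once as a
column, hence each `w a` exactly twice. -/
theorem isEntrywiseQuadratic_eval_gramPoly (c : ℂ) :
    IsEntrywiseQuadratic fun X : Fin n → Fin m → ℂ => (gramPoly X).eval c := by
  have e : ∀ X : Fin n → Fin m → ℂ, (gramPoly X).eval c =
      (Matrix.scalar (Fin m) c - gramMatrix X).det := fun X => Matrix.eval_charpoly _ _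
  simp_rw [e]
  refine ⟨?_, ((m)! : ℝ) * (‖c‖ + n) ^ m, fun X => ?_⟩
  · refine Continuous.matrix_det (continuous_const.sub ?_)
    refine continuous_matrix fun a b => ?_
    simp_rw [gramMatrix_apply]
    fun_prop
  · set w : Fin m → ℝ := fun a => ∏ i, (1 + ‖X i a‖) with hw
    have hprod : ∀ (s : Finset (Fin n)) (a : Fin m), 1 ≤ ∏ i ∈ s, (1 + ‖X i a‖) := fun s a => by
      have := Finset.prod_le_prod (s := s) (f := fun _ => (1 : ℝ)) (g := fun i => 1 + ‖X i a‖)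
        (fun _ _ => zero_le_one) (fun i _ => by linarith [norm_nonneg (X i a)])
      simpa using this
    have hw1 : ∀ a, 1 ≤ w a := hprod Finset.univ
    have hXw : ∀ i a, ‖X i a‖ ≤ w a := fun i a => by
      simp only [hw]
      rw [← Finset.mul_prod_erase _ (fun i => 1 + ‖X i a‖) (Finset.mem_univ i)]
      have h0 := norm_nonneg (X i a)
      nlinarith [hprod (Finset.univ.erase i) a]
    have hM : ∀ a b, ‖(Matrix.scalar (Fin m) c - gramMatrix X) a b‖ ≤ (‖c‖ + n) * (w a * w b) := by
      intro a b
      rw [Matrix.sub_apply, Matrix.scalar_apply, Matrix.diagonal_apply, gramMatrix_apply]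
      refine (norm_sub_le _ _).trans ?_
      rw [add_mul]
      refine add_le_add ?_ ?_
      · have : ‖(if a = b then c else 0)‖ ≤ ‖c‖ := by split_ifs <;> simp
        refine this.trans (le_mul_of_one_le_right (norm_nonneg _) ?_)
        exact one_le_mul_of_one_le_of_one_le (hw1 a) (hw1 b)
      · refine (norm_sum_le _ _).trans ((Finset.sum_le_card_nsmul _ _ (w a * w b)
          fun i _ => ?_).trans ?_)
        · rw [norm_mul, norm_star]
          exact mul_le_mul (hXw i a) (hXw i b) (norm_nonneg _) (zero_le_one.trans (hw1 a))
        · simp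
    beta_reduce
    rw [Matrix.det_apply]
    refine (norm_sum_le _ _).trans ((Finset.sum_le_card_nsmul _ _
      ((‖c‖ + n) ^ m * ∏ i, ∏ j, (1 + ‖X i j‖) ^ 2) fun σ _ => ?_).trans ?_)
    · rw [Units.smul_def, zsmul_eq_mul, norm_mul, norm_prod]
      have : ‖((Equiv.Perm.sign σ : ℤ) : ℂ)‖ = 1 := by
        rcases Int.units_eq_one_or (Equiv.Perm.sign σ) with h | h <;> simp [h]
      rw [this, one_mul]
      refine (Finset.prod_le_prod (fun _ _ => norm_nonneg _) fun a _ => hM (σ a) a).trans ?_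
      rw [Finset.prod_mul_distrib, Finset.prod_mul_distrib, Equiv.prod_comp σ w]
      simp only [Finset.prod_const, Finset.card_univ, Fintype.card_fin, Finset.prod_pow]
      rw [Finset.prod_comm, ← sq]
    · rw [Finset.card_univ, Fintype.card_perm, Fintype.card_fin, nsmul_eq_mul, mul_assoc]

/-- Lagrange interpolation at `0, …, m` determines a polynomial of degree `m`, so every linear
functional of it is a fixed combination of point evaluations. -/
theorem isEntrywiseQuadratic_gramPoly (Φ : ℂ[X] →ₗ[ℂ] ℂ) :
    IsEntrywiseQuadratic fun X : Fin n → Fin m → ℂ => Φ (gramPoly X) := by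
  have e : ∀ X : Fin n → Fin m → ℂ, Φ (gramPoly X) = ∑ i ∈ Finset.range (m + 1),
      (gramPoly X).eval (i : ℂ) *
        Φ (Lagrange.basis (Finset.range (m + 1)) (fun i : ℕ => (i : ℂ)) i) := by
    intro X
    have h := Lagrange.eq_interpolate (f := gramPoly X) (s := Finset.range (m + 1))
      (v := fun i : ℕ => (i : ℂ)) (Nat.cast_injective.injOn) (by
        rw [gramPoly, Matrix.charpoly_degree_eq_dim]
        rw [Finset.card_range, Fintype.card_fin]
        exact_mod_cast Nat.lt_succ_self m)
    conv_lhs => rw [h, Lagrange.interpolate_apply, map_sum]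
    refine Finset.sum_congr rfl fun i _ => ?_
    rw [C_mul', map_smul, smul_eq_mul]
  simp_rw [e]
  exact IsEntrywiseQuadratic.sum _ fun i => (isEntrywiseQuadratic_eval_gramPoly _).mul_const _

/-- The law of a matrix with independent entries of law `ρ`, as a product over the rows. -/
noncomputable def rowsLaw (ρ : Measure ℂ) (n m : ℕ) : Measure (Fin n → Fin m → ℂ) :=
  Measure.pi fun _ => Measure.pi fun _ => ρ

variable {ρ : Measure ℂ} [IsProbabilityMeasure ρ] {κ : ℂ}

instance : IsProbabilityMeasure (rowsLaw ρ n m) := by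
  unfold rowsLaw; infer_instance

/-- Two quadratic bounds multiply to a product of fourth powers of independent entries, integrable
by the fourth moment assumption. -/
theorem IsStandardEntry.integrable_mul (h : IsStandardEntry ρ κ) {F G : (Fin n → Fin m → ℂ) → ℂ}
    (hF : IsEntrywiseQuadratic F) (hG : IsEntrywiseQuadratic G) :
    Integrable (fun X => F X * G X) (rowsLaw ρ n m) := by
  obtain ⟨hFc, K, hK⟩ := hF
  obtain ⟨hGc, L, hL⟩ := hG
  have hi : Integrable (fun X : Fin n → Fin m → ℂ => ∏ i, ∏ j, (1 + ‖X i j‖) ^ 4)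
      (rowsLaw ρ n m) :=
    Integrable.fintype_prod (f := fun _ (v : Fin m → ℂ) => ∏ j, (1 + ‖v j‖) ^ 4) fun i =>
      Integrable.fintype_prod (f := fun _ (z : ℂ) => (1 + ‖z‖) ^ 4) fun j => h.integrable
  refine (hi.const_mul (K * L)).mono' (hFc.mul hGc).aestronglyMeasurable
    (ae_of_all _ fun X => ?_)
  rw [norm_mul]
  refine (mul_le_mul (hK X) (hL X) (norm_nonneg _) ((norm_nonneg _).trans (hK X))).trans_eq ?_
  have : ∏ i, ∏ j, (1 + ‖X i j‖) ^ 4 =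
      (∏ i, ∏ j, (1 + ‖X i j‖) ^ 2) * ∏ i, ∏ j, (1 + ‖X i j‖) ^ 2 := by
    simp_rw [← Finset.prod_mul_distrib, ← pow_add]
  rw [this]; ring

theorem measurePreserving_dropColumn (k : Fin (m + 1)) :
    MeasurePreserving (dropColumn k) (rowsLaw ρ n (m + 1)) (rowsLaw ρ n m) := by
  refine measurePreserving_pi (f := fun _ (v : Fin (m + 1) → ℂ) j => v (k.succAbove j)) _ _
    fun i => ?_
  exact measurePreserving_snd.comp (measurePreserving_piFinSuccAbove (fun _ => ρ) k)

theorem integral_rowsLaw_succ {F : (Fin (n + 1) → Fin m → ℂ) → ℂ}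
    (hF : Integrable F (rowsLaw ρ (n + 1) m)) :
    ∫ X, F X ∂(rowsLaw ρ (n + 1) m) =
      ∫ X, ∫ v, F (Fin.cons v X : Fin (n + 1) → Fin m → ℂ) ∂(Measure.pi fun _ => ρ)
        ∂(rowsLaw ρ n m) := by
  have h := (measurePreserving_piFinSuccAbove
    (fun _ : Fin (n + 1) => Measure.pi fun _ : Fin m => ρ) 0).symm
  have hi := (h.integrable_comp_emb (MeasurableEquiv.measurableEmbedding _)).mpr hF
  rw [rowsLaw, ← h.integral_comp']
  refine (integral_prod_symm _ hi).trans ?_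
  have hc : ∀ (v : Fin m → ℂ) (X : Fin n → Fin m → ℂ),
      (MeasurableEquiv.piFinSuccAbove (fun _ : Fin (n + 1) => Fin m → ℂ) 0).symm (v, X) =
        Fin.cons v X := fun v X => by
    ext i
    refine Fin.cases ?_ (fun i => ?_) i <;> simp
  simp only [Function.comp, hc]
  rfl

end Gram

end

/-! ### The recursion for the expected skew form -/

section

open Polynomial

/-- The operator `1 - d/dX` on polynomials. -/
noncomputable def oneSubDerivative : ℂ[X] →ₗ[ℂ] ℂ[X] := LinearMap.id - derivative

/-- The polynomial `(1 - d/dX) ^ n X ^ m`, which is `(-1) ^ m m!` times a Laguerre polynomial. -/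
noncomputable def laguerrePoly (n m : ℕ) : ℂ[X] := oneSubDerivative^[n] (X ^ m)

theorem laguerrePoly_succ (n m : ℕ) :
    laguerrePoly (n + 1) m = oneSubDerivative (laguerrePoly n m) := by
  rw [laguerrePoly, Function.iterate_succ_apply', laguerrePoly]

/-- The skew form `(p, r) ↦ Φ (X p) Ψ r - Φ p Ψ (X r)`. -/
noncomputable def skewForm (Φ Ψ : ℂ[X] →ₗ[ℂ] ℂ) (p r : ℂ[X]) : ℂ :=
  Φ (X * p) * Ψ r - Φ p * Ψ (X * r)

/-- The antisymmetrized product of two consecutive Laguerre polynomials. -/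
noncomputable def laguerreSkew (Φ Ψ : ℂ[X] →ₗ[ℂ] ℂ) (n m : ℕ) : ℂ :=
  Φ (laguerrePoly n (m + 1)) * Ψ (laguerrePoly n m) -
    Φ (laguerrePoly n m) * Ψ (laguerrePoly n (m + 1))

theorem laguerreSkew_comp (Φ Ψ : ℂ[X] →ₗ[ℂ] ℂ) (n m : ℕ) :
    laguerreSkew (Φ ∘ₗ oneSubDerivative) (Ψ ∘ₗ oneSubDerivative) n m =
      laguerreSkew Φ Ψ (n + 1) m := by
  simp [laguerreSkew, laguerrePoly_succ]

section Recursion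

variable {n m : ℕ} {ρ : Measure ℂ} [IsProbabilityMeasure ρ] {κ : ℂ}

theorem IsStandardEntry.integrable_skewForm (h : IsStandardEntry ρ κ) (Φ Ψ : ℂ[X] →ₗ[ℂ] ℂ) :
    Integrable (fun X : Fin n → Fin m → ℂ => skewForm Φ Ψ (gramPoly X) (gramPoly X))
      (rowsLaw ρ n m) :=
  (h.integrable_mul (isEntrywiseQuadratic_gramPoly (Φ ∘ₗ LinearMap.mulLeft ℂ X))
    (isEntrywiseQuadratic_gramPoly Ψ)).sub
  (h.integrable_mul (isEntrywiseQuadratic_gramPoly Φ)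
    (isEntrywiseQuadratic_gramPoly (Ψ ∘ₗ LinearMap.mulLeft ℂ X)))

open scoped ComplexConjugate in
theorem map_gramPoly_cons (Φ : ℂ[X] →ₗ[ℂ] ℂ) (v : Fin m → ℂ) (X : Fin n → Fin m → ℂ) :
    Φ (gramPoly (Fin.cons v X : Fin (n + 1) → Fin m → ℂ)) = Φ (gramPoly X) +
      ∑ i, ∑ j, conj (v i) * v j * (-Φ ((gramMatrix X).charmatrix.adjugate j i)) := by
  rw [gramPoly_cons, map_add, map_sum]
  simp_rw [map_sum, map_smul, map_neg, smul_eq_mul]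

/-- The expected effect of an additional row on the skew form of the characteristic polynomial. -/
theorem IsStandardEntry.integral_skewForm_cons (h : IsStandardEntry ρ κ) (Φ Ψ : ℂ[X] →ₗ[ℂ] ℂ)
    (X : Fin n → Fin m → ℂ) :
    ∫ v, skewForm Φ Ψ (gramPoly (Fin.cons v X : Fin (n + 1) → Fin m → ℂ))
        (gramPoly (Fin.cons v X : Fin (n + 1) → Fin m → ℂ)) ∂(Measure.pi fun _ => ρ) =
      skewForm (Φ ∘ₗ oneSubDerivative) (Ψ ∘ₗ oneSubDerivative) (gramPoly X) (gramPoly X) +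
        κ * ∑ i, skewForm Φ Ψ ((gramMatrix X).charmatrix.adjugate i i)
          ((gramMatrix X).charmatrix.adjugate i i) := by
  set B := (gramMatrix X).charmatrix.adjugate with hB
  have key : ∀ Φ Ψ : ℂ[X] →ₗ[ℂ] ℂ,
      Integrable (fun v => Φ (gramPoly (Fin.cons v X : Fin (n + 1) → Fin m → ℂ)) *
        Ψ (gramPoly (Fin.cons v X : Fin (n + 1) → Fin m → ℂ))) (Measure.pi fun _ => ρ) ∧
      ∫ v, Φ (gramPoly (Fin.cons v X : Fin (n + 1) → Fin m → ℂ)) *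
        Ψ (gramPoly (Fin.cons v X : Fin (n + 1) → Fin m → ℂ)) ∂(Measure.pi fun _ => ρ) =
      Φ (oneSubDerivative (gramPoly X)) * Ψ (oneSubDerivative (gramPoly X)) +
        ∑ i, ∑ j, Φ (B i j) * Ψ (B j i) + κ * ∑ i, Φ (B i i) * Ψ (B i i) := by
    intro Φ Ψ
    simp_rw [map_gramPoly_cons, ← hB]
    refine ⟨h.integrable_quadratic (fun i j => -Φ (B j i)) (fun i j => -Ψ (B j i)) _ _, ?_⟩
    rw [h.integral_quadratic (fun i j => -Φ (B j i)) (fun i j => -Ψ (B j i))]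
    have e : ∀ Φ : ℂ[X] →ₗ[ℂ] ℂ, Φ (gramPoly X) + ∑ i, -Φ (B i i) =
        Φ (oneSubDerivative (gramPoly X)) := by
      intro Φ
      rw [oneSubDerivative, LinearMap.sub_apply, LinearMap.id_apply, map_sub, gramPoly,
        derivative_charpoly_eq_trace_adjugate, map_sum, Finset.sum_neg_distrib, sub_eq_add_neg]
    rw [e, e]
    simp only [neg_mul_neg]
    rw [Finset.sum_comm]
  have k1 := key (Φ ∘ₗ LinearMap.mulLeft ℂ Polynomial.X) Ψ
  have k2 := key Φ (Ψ ∘ₗ LinearMap.mulLeft ℂ Polynomial.X)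
  simp only [LinearMap.comp_apply, LinearMap.mulLeft_apply] at k1 k2
  unfold skewForm
  rw [integral_sub k1.1 k2.1, k1.2, k2.2]
  -- With `q = p - p'`, the adjugate double sum reduces to `Φ q Ψ p - Φ p Ψ q`. This is exactly the
  -- correction from commuting `1 - d/dX` past multiplication by `X` in `h4`.
  have h3 := sum_adjugate_charmatrix_skew (gramMatrix X) Φ Ψ
  rw [← hB] at h3
  simp_rw [Finset.sum_sub_distrib] at h3 ⊢
  have h4 : ∀ p : ℂ[X], oneSubDerivative (Polynomial.X * p) =
      Polynomial.X * oneSubDerivative p - p := by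
    intro p
    simp only [oneSubDerivative, LinearMap.sub_apply, LinearMap.id_apply, derivative_mul,
      derivative_X]
    ring
  simp only [LinearMap.comp_apply, h4, map_sub, mul_sub]
  have h5 : derivative (gramPoly X) = gramPoly X - oneSubDerivative (gramPoly X) := by
    simp [oneSubDerivative]
  rw [← gramPoly, h5, map_sub, map_sub] at h3
  linear_combination h3

/-- The expected skew form of the characteristic polynomial of `X* X`. -/
theorem IsStandardEntry.integral_skewForm (h : IsStandardEntry ρ κ) (n : ℕ) :
    ∀ (m : ℕ) (Φ Ψ : ℂ[X] →ₗ[ℂ] ℂ),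
      ∫ X : Fin n → Fin m → ℂ, skewForm Φ Ψ (gramPoly X) (gramPoly X) ∂(rowsLaw ρ n m) =
        ∑ d ∈ Finset.range (n + 1), (n.choose d * m.choose d * d ! : ℕ) * κ ^ d *
          laguerreSkew Φ Ψ (n - d) (m - d) := by
  induction n with
  | zero =>
    intro m Φ Ψ
    have : ∀ X : Fin 0 → Fin m → ℂ, gramPoly X = Polynomial.X ^ m := by
      intro X
      have : gramMatrix X = 0 := by ext a b; simp [gramMatrix_apply]
      rw [gramPoly, this, Matrix.charpoly_zero, Fintype.card_fin]
    simp [this, skewForm, laguerreSkew, laguerrePoly, pow_succ']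
  | succ n ih =>
    intro m Φ Ψ
    rw [integral_rowsLaw_succ (h.integrable_skewForm Φ Ψ)]
    simp_rw [h.integral_skewForm_cons]
    -- Without columns there is no diagonal adjugate entry, so the `κ` term is empty.
    cases m with
    | zero =>
      simp only [Finset.univ_eq_empty, Finset.sum_empty, mul_zero, add_zero, ih, laguerreSkew_comp]
      rw [Finset.sum_range_succ', Finset.sum_range_succ']
      simp
    | succ m =>
      have hp := fun k => measurePreserving_dropColumn (ρ := ρ) (n := n) (m := m) k
      have hi : ∀ k, Integrable (fun X : Fin n → Fin (m + 1) → ℂ => skewForm Φ Ψ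
          (gramPoly (dropColumn k X)) (gramPoly (dropColumn k X))) (rowsLaw ρ n (m + 1)) :=
        fun k => (hp k).integrable_comp_of_integrable (h.integrable_skewForm Φ Ψ)
      have hv : ∀ k, ∫ X : Fin n → Fin (m + 1) → ℂ, skewForm Φ Ψ
          (gramPoly (dropColumn k X)) (gramPoly (dropColumn k X)) ∂(rowsLaw ρ n (m + 1)) =
          ∫ X, skewForm Φ Ψ (gramPoly X) (gramPoly X) ∂(rowsLaw ρ n m) := fun k => by
        rw [← (hp k).map_eq, integral_map (hp k).measurable.aemeasurable]
        rw [(hp k).map_eq]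
        exact (h.integrable_skewForm Φ Ψ).aestronglyMeasurable
      simp_rw [adjugate_charmatrix_gramMatrix_self]
      rw [integral_add (h.integrable_skewForm _ _)
        ((integrable_finsetSum _ fun k _ => hi k).const_mul κ), integral_const_mul,
        integral_finsetSum _ fun k _ => hi k]
      simp_rw [hv, ih, laguerreSkew_comp]
      rw [Finset.sum_const, Finset.card_univ, Fintype.card_fin, nsmul_eq_mul]
      rw [Finset.sum_range_succ' _ (n + 1)]
      have e1 : ∑ d ∈ Finset.range (n + 1), ((n.choose d * (m + 1).choose d * d ! : ℕ) : ℂ) * κ ^ d *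
          laguerreSkew Φ Ψ (n - d + 1) (m + 1 - d) =
          ∑ d ∈ Finset.range (n + 1), ((n.choose (d + 1) * (m + 1).choose (d + 1) * (d + 1)! : ℕ) : ℂ)
            * κ ^ (d + 1) * laguerreSkew Φ Ψ (n - d) (m - d) + laguerreSkew Φ Ψ (n + 1) (m + 1) := by
        have : ∑ d ∈ Finset.range (n + 1), ((n.choose d * (m + 1).choose d * d ! : ℕ) : ℂ) * κ ^ d *
          laguerreSkew Φ Ψ (n - d + 1) (m + 1 - d) =
          ∑ d ∈ Finset.range (n + 2), ((n.choose d * (m + 1).choose d * d ! : ℕ) : ℂ) * κ ^ d *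
          laguerreSkew Φ Ψ (n + 1 - d) (m + 1 - d) := by
          rw [Finset.sum_range_succ _ (n + 1), Nat.choose_succ_self]
          simp only [zero_mul, Nat.cast_zero, add_zero]
          refine Finset.sum_congr rfl fun d hd => ?_
          rw [show n + 1 - d = n - d + 1 by have := Finset.mem_range.mp hd; omega]
        rw [this, Finset.sum_range_succ' _ (n + 1)]
        simp
      rw [e1, add_right_comm, Finset.mul_sum, Finset.mul_sum, ← Finset.sum_add_distrib]
      congr 1
      · refine Finset.sum_congr rfl fun d _ => ?_
        -- Coefficient check: Pascal's rule in `n` joins the two sources of the term `d + 1`, and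
        -- `(m + 1) C(m, d) = (d + 1) C(m + 1, d + 1)` absorbs the number of columns that can be
        -- dropped.
        have h1 := Nat.add_one_mul_choose_eq m d
        have h2 : ((m + 1 : ℕ) : ℂ) * m.choose d = (m + 1).choose (d + 1) * (d + 1 : ℕ) := by
          exact_mod_cast h1
        rw [Nat.choose_succ_succ n d, Nat.factorial_succ, Nat.add_sub_add_right,
          Nat.add_sub_add_right]
        push_cast at h2 ⊢
        linear_combination (κ ^ (d + 1) * n.choose d * d ! * laguerreSkew Φ Ψ (n - d) (m - d)) * h2
      · simp

end Recursion

end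

/-! ### Laguerre polynomials and the exact finite-size formula -/

section

open Polynomial

/-- The commutator of `1 - d/dX` with multiplication by `X` is `-1`; iterating it gives the
recurrence of the Laguerre polynomials in `m`. -/
theorem oneSubDerivative_iterate_succ_X_mul (n : ℕ) (p : ℂ[X]) :
    oneSubDerivative^[n + 1] (X * p) =
      X * oneSubDerivative^[n + 1] p - (n + 1 : ℂ[X]) * oneSubDerivative^[n] p := by
  induction n with
  | zero => simp [oneSubDerivative]; ring
  | succ n ih =>
    rw [Function.iterate_succ_apply', ih, Function.iterate_succ_apply' _ (n + 1),
      Function.iterate_succ_apply' _ n]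
    simp only [oneSubDerivative, LinearMap.sub_apply, LinearMap.id_apply, derivative_sub,
      derivative_mul, derivative_X, derivative_add, derivative_natCast, derivative_one]
    push_cast
    ring

theorem laguerrePoly_succ_right (n m : ℕ) :
    laguerrePoly (n + 1) (m + 1) =
      X * laguerrePoly (n + 1) m - (n + 1 : ℂ[X]) * laguerrePoly n m := by
  rw [laguerrePoly, pow_succ', oneSubDerivative_iterate_succ_X_mul, laguerrePoly, laguerrePoly]

theorem laguerrePoly_succ_succ (n m : ℕ) :
    laguerrePoly (n + 1) (m + 1) =
      laguerrePoly n (m + 1) - (m + 1 : ℂ) • laguerrePoly n m := by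
  have h : oneSubDerivative (X ^ (m + 1)) = X ^ (m + 1) - (m + 1 : ℂ) • X ^ m := by
    simp [oneSubDerivative, smul_eq_C_mul]
  have e : ∀ p, oneSubDerivative^[n] p = (oneSubDerivative ^ n) p := fun p => by
    rw [Module.End.pow_apply]
  rw [laguerrePoly, Function.iterate_succ_apply, h, e, map_sub, map_smul, ← e, ← e, laguerrePoly,
    laguerrePoly]

theorem laguerrePoly_zero_right (n : ℕ) : laguerrePoly n 0 = 1 := by
  induction n with
  | zero => simp [laguerrePoly]
  | succ n ih => rw [laguerrePoly_succ, ih]; simp [oneSubDerivative]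

theorem laguerrePoly_zero_left (m : ℕ) : laguerrePoly 0 m = X ^ m := rfl

/-- A Christoffel-Darboux formula for Laguerre polynomials along a diagonal. -/
theorem laguerreSkew_eval (x y : ℂ) (n : ℕ) : ∀ m : ℕ,
    laguerreSkew (leval x) (leval y) n m = (x - y) * ∑ j ∈ Finset.range (n + 1),
      ((n.descFactorial j * m.descFactorial j : ℕ) : ℂ) *
        ((laguerrePoly (n - j) (m - j)).eval x * (laguerrePoly (n - j) (m - j)).eval y) := by
  induction n with
  | zero =>
    intro m
    simp [laguerreSkew, laguerrePoly_zero_left]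
    ring
  | succ n ih =>
    intro m
    rw [Finset.sum_range_succ']
    cases m with
    | zero =>
      simp [laguerreSkew, laguerrePoly_zero_right, laguerrePoly_succ_right]
    | succ m =>
      have hs : ∑ j ∈ Finset.range (n + 1),
          (((n + 1).descFactorial (j + 1) * (m + 1).descFactorial (j + 1) : ℕ) : ℂ) *
          ((laguerrePoly (n + 1 - (j + 1)) (m + 1 - (j + 1))).eval x *
            (laguerrePoly (n + 1 - (j + 1)) (m + 1 - (j + 1))).eval y) =
          (n + 1) * (m + 1) * ∑ j ∈ Finset.range (n + 1),
          ((n.descFactorial j * m.descFactorial j : ℕ) : ℂ) *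
          ((laguerrePoly (n - j) (m - j)).eval x * (laguerrePoly (n - j) (m - j)).eval y) := by
        rw [Finset.mul_sum]
        refine Finset.sum_congr rfl fun j _ => ?_
        rw [Nat.succ_descFactorial_succ, Nat.succ_descFactorial_succ, Nat.add_sub_add_right,
          Nat.add_sub_add_right]
        push_cast
        ring
      -- The recurrence in `m` produces `x - y` times the diagonal product, and the second
      -- recurrence turns the remainder into `(n + 1)(m + 1)` times the skew form at `(n, m)`.
      rw [hs, mul_add, mul_left_comm, ← ih m]
      have h1 := laguerrePoly_succ_right n (m + 1)
      have h2 := laguerrePoly_succ_succ n m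
      simp only [laguerreSkew, leval_apply, h1, eval_sub, eval_mul, eval_X, eval_add, eval_natCast,
        eval_one, Nat.descFactorial_zero, Nat.sub_zero, Nat.cast_one, one_mul]
      have h3 : ∀ z : ℂ, (laguerrePoly (n + 1) (m + 1)).eval z =
          (laguerrePoly n (m + 1)).eval z - (m + 1) * (laguerrePoly n m).eval z := fun z => by
        rw [h2, eval_sub, eval_smul, smul_eq_mul]
      rw [h3, h3]
      ring

/-- The summand of the kernel of the Laguerre ensemble. -/
noncomputable def laguerreTerm (n m : ℕ) (x y : ℂ) : ℂ :=
  (laguerrePoly n m).eval x * (laguerrePoly n m).eval y / (n ! * m !)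

section Correlation

variable {n m : ℕ} {ρ : Measure ℂ} [IsProbabilityMeasure ρ] {κ : ℂ}

/-- Expanding in coefficients shows that the integral is a polynomial in `x`. The continuity extends
the formula to `x = y`, where the skew form vanishes and carries no information. -/
theorem IsStandardEntry.continuous_integral_eval (h : IsStandardEntry ρ κ) (y : ℂ) :
    Continuous fun x => ∫ X : Fin n → Fin m → ℂ, (gramPoly X).eval x * (gramPoly X).eval y
      ∂(rowsLaw ρ n m) := by
  have e : ∀ x, ∫ X : Fin n → Fin m → ℂ, (gramPoly X).eval x * (gramPoly X).eval y
      ∂(rowsLaw ρ n m) = ∑ i ∈ Finset.range (m + 1),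
      x ^ i * ∫ X : Fin n → Fin m → ℂ, (gramPoly X).coeff i * (gramPoly X).eval y
        ∂(rowsLaw ρ n m) := by
    intro x
    have hi : ∀ i, Integrable (fun X : Fin n → Fin m → ℂ =>
        (gramPoly X).coeff i * (gramPoly X).eval y) (rowsLaw ρ n m) := fun i =>
      h.integrable_mul (isEntrywiseQuadratic_gramPoly (lcoeff ℂ i))
        (isEntrywiseQuadratic_gramPoly (leval y))
    simp_rw [← integral_const_mul]
    rw [← integral_finsetSum _ fun i _ => (hi i).const_mul _]
    refine integral_congr_ae (ae_of_all _ fun X => ?_)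
    beta_reduce
    rw [eval_eq_sum_range' (n := m + 1) (by
      rw [gramPoly, Matrix.charpoly_natDegree_eq_dim, Fintype.card_fin]; omega), Finset.sum_mul]
    exact Finset.sum_congr rfl fun i _ => by ring
  simp_rw [e]
  fun_prop

theorem IsStandardEntry.integral_eval_mul_eval (h : IsStandardEntry ρ κ) (x y : ℂ) :
    ∫ X : Fin n → Fin m → ℂ, (gramPoly X).eval x * (gramPoly X).eval y ∂(rowsLaw ρ n m) =
      ∑ d ∈ Finset.range (n + 1), (n.choose d * m.choose d * d ! : ℕ) * κ ^ d *
        ∑ j ∈ Finset.range (n - d + 1),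
          (((n - d).descFactorial j * (m - d).descFactorial j : ℕ) : ℂ) *
            ((laguerrePoly (n - d - j) (m - d - j)).eval x *
              (laguerrePoly (n - d - j) (m - d - j)).eval y) := by
  have hoff : ∀ x ∈ ({y}ᶜ : Set ℂ), ∫ X : Fin n → Fin m → ℂ,
      (gramPoly X).eval x * (gramPoly X).eval y ∂(rowsLaw ρ n m) =
      ∑ d ∈ Finset.range (n + 1), (n.choose d * m.choose d * d ! : ℕ) * κ ^ d *
        ∑ j ∈ Finset.range (n - d + 1),
          (((n - d).descFactorial j * (m - d).descFactorial j : ℕ) : ℂ) *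
            ((laguerrePoly (n - d - j) (m - d - j)).eval x *
              (laguerrePoly (n - d - j) (m - d - j)).eval y) := by
    intro x hx
    have hne : x - y ≠ 0 := sub_ne_zero.mpr hx
    apply mul_left_cancel₀ hne
    have h1 := h.integral_skewForm n m (leval x) (leval y)
    simp_rw [laguerreSkew_eval, mul_left_comm _ (x - y)] at h1
    rw [← Finset.mul_sum] at h1
    rw [← h1, ← integral_const_mul]
    refine integral_congr_ae (ae_of_all _ fun X => ?_)
    simp only [skewForm, leval_apply, eval_mul, eval_X]
    ring
  -- Both sides are continuous in `x` and agree on the dense set `x ≠ y`.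
  refine congrFun (Continuous.ext_on (dense_compl_singleton y) (h.continuous_integral_eval y) ?_
    hoff) x
  refine continuous_finsetSum _ fun d _ => continuous_const.mul (continuous_finsetSum _ fun j _ =>
    continuous_const.mul ((Polynomial.continuous _).mul continuous_const))

/-- With `k = d + j` the binomials and falling factorials combine to `n! m! / (d! (n-k)! (m-k)!)`.
Terms with `d` or `k` beyond `m` vanish, which cuts both sums at `m`. -/
theorem IsStandardEntry.integral_div_factorial (h : IsStandardEntry ρ κ) (hmn : m ≤ n) (x y : ℂ) :
    (∫ X : Fin n → Fin m → ℂ, (gramPoly X).eval x * (gramPoly X).eval y ∂(rowsLaw ρ n m)) /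
        (n ! * m !) =
      ∑ d ∈ Finset.range (m + 1), κ ^ d / d ! *
        ∑ k ∈ Finset.Ico d (m + 1), laguerreTerm (n - k) (m - k) x y := by
  rw [h.integral_eval_mul_eval, Finset.sum_div,
    ← Finset.sum_subset (Finset.range_subset_range.mpr (Nat.succ_le_succ hmn))]
  · refine Finset.sum_congr rfl fun d hd => ?_
    have hdm : d ≤ m := Nat.lt_succ_iff.mp (Finset.mem_range.mp hd)
    rw [Finset.sum_Ico_eq_sum_range, Nat.succ_sub hdm,
      ← Finset.sum_subset (Finset.range_subset_range.mpr
        (Nat.succ_le_succ (Nat.sub_le_sub_right hmn d)))]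
    · rw [Finset.mul_sum, Finset.mul_sum, Finset.sum_div]
      refine Finset.sum_congr rfl fun j hj => ?_
      have hjm : j ≤ m - d := Nat.lt_succ_iff.mp (Finset.mem_range.mp hj)
      have e1 : ((n - d).descFactorial j : ℂ) * (n - d - j)! = (n - d)! := by
        have := Nat.factorial_mul_descFactorial (hjm.trans (Nat.sub_le_sub_right hmn d))
        rw [mul_comm]; exact_mod_cast this
      have e2 : ((m - d).descFactorial j : ℂ) * (m - d - j)! = (m - d)! := by
        have := Nat.factorial_mul_descFactorial hjm
        rw [mul_comm]; exact_mod_cast this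
      have e3 : (n.choose d : ℂ) * d ! * (n - d)! = n ! := by
        exact_mod_cast Nat.choose_mul_factorial_mul_factorial (hdm.trans hmn)
      have e4 : (m.choose d : ℂ) * d ! * (m - d)! = m ! := by
        exact_mod_cast Nat.choose_mul_factorial_mul_factorial hdm
      rw [laguerreTerm, ← Nat.sub_sub, ← Nat.sub_sub, ← e3, ← e4, ← e1, ← e2]
      have f1 : (d ! : ℂ) ≠ 0 := by exact_mod_cast d.factorial_ne_zero
      have f2 : ((n - d - j)! : ℂ) ≠ 0 := by exact_mod_cast Nat.factorial_ne_zero _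
      have f3 : ((m - d - j)! : ℂ) ≠ 0 := by exact_mod_cast Nat.factorial_ne_zero _
      have f4 : ((n - d).descFactorial j : ℂ) ≠ 0 := by
        intro h0; rw [h0, zero_mul] at e1
        exact Nat.factorial_ne_zero (n - d) (by exact_mod_cast e1.symm)
      have f5 : ((m - d).descFactorial j : ℂ) ≠ 0 := by
        intro h0; rw [h0, zero_mul] at e2
        exact Nat.factorial_ne_zero (m - d) (by exact_mod_cast e2.symm)
      have f6 : (n.choose d : ℂ) ≠ 0 := by
        exact_mod_cast (Nat.choose_pos (hdm.trans hmn)).ne'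
      have f7 : (m.choose d : ℂ) ≠ 0 := by exact_mod_cast (Nat.choose_pos hdm).ne'
      push_cast
      field_simp
    · intro j _ hj
      have : m - d < j := by simpa using hj
      rw [(Nat.descFactorial_eq_zero_iff_lt (n := m - d)).mpr this]
      simp
  · intro d _ hd
    have : m < d := by simpa using hd
    rw [Nat.choose_eq_zero_of_lt this]
    simp

end Correlation

end

/-! ### From the real law `Q` to the complex entries -/

section

open Polynomial

section EntryLaw

theorem measurable_complex_mk : Measurable fun p : ℝ × ℝ => (⟨p.1, p.2⟩ : ℂ) :=
  Complex.measurableEquivRealProd.symm.measurable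

variable {Q : Measure ℝ} [IsProbabilityMeasure Q]

instance isProbabilityMeasure_complexEntryLaw : IsProbabilityMeasure (complexEntryLaw Q) :=
  Measure.isProbabilityMeasure_map measurable_complex_mk.aemeasurable

theorem integrable_pow_of_integrable_pow_four (h4 : Integrable (fun x : ℝ => x ^ 4) Q) {k : ℕ}
    (hk : k ≤ 4) : Integrable (fun x : ℝ => x ^ k) Q := by
  refine ((integrable_const (1 : ℝ)).add h4).mono' (by fun_prop) (ae_of_all _ fun x => ?_)
  rw [Real.norm_eq_abs, abs_pow, Pi.add_apply, ← Even.pow_abs (by decide : Even 4) x]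
  rcases le_total |x| 1 with h | h
  · have := pow_le_one₀ (n := k) (abs_nonneg x) h
    have := pow_nonneg (abs_nonneg x) 4
    linarith
  · have := pow_le_pow_right₀ h hk
    linarith

theorem integrable_ofReal_pow_mul_pow (h4 : Integrable (fun x : ℝ => x ^ 4) Q) {j k : ℕ}
    (hj : j ≤ 4) (hk : k ≤ 4) :
    Integrable (fun p : ℝ × ℝ => (p.1 : ℂ) ^ j * (p.2 : ℂ) ^ k) (Q.prod Q) := by
  have h1 := (integrable_pow_of_integrable_pow_four h4 hj).ofReal (𝕜 := ℂ)
  have h2 := (integrable_pow_of_integrable_pow_four h4 hk).ofReal (𝕜 := ℂ)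
  have := h1.mul_prod h2
  simpa using this

theorem integral_ofReal_pow_mul_pow (j k : ℕ) :
    ∫ p : ℝ × ℝ, (p.1 : ℂ) ^ j * (p.2 : ℂ) ^ k ∂(Q.prod Q) =
      ((∫ x, x ^ j ∂Q : ℝ) : ℂ) * ((∫ x, x ^ k ∂Q : ℝ) : ℂ) := by
  rw [integral_prod_mul (fun x : ℝ => (x : ℂ) ^ j) (fun x : ℝ => (x : ℂ) ^ k)]
  simp_rw [← Complex.ofReal_pow, integral_complex_ofReal]

/-- The expectation of a polynomial in the real and imaginary parts. -/
theorem integral_complexEntryLaw_eq_sum (h4 : Integrable (fun x : ℝ => x ^ 4) Q) {ι : Type*}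
    (s : Finset ι) (c : ι → ℂ) (j k : ι → ℕ) (hj : ∀ i, j i ≤ 4) (hk : ∀ i, k i ≤ 4) (f : ℂ → ℂ)
    (hfc : Continuous f) (hf : ∀ x y : ℝ, f ⟨x, y⟩ = ∑ i ∈ s, c i * ((x : ℂ) ^ j i * (y : ℂ) ^ k i)) :
    ∫ z, f z ∂(complexEntryLaw Q) =
      ∑ i ∈ s, c i * (((∫ x, x ^ j i ∂Q : ℝ) : ℂ) * ((∫ x, x ^ k i ∂Q : ℝ) : ℂ)) := by
  rw [complexEntryLaw, integral_map measurable_complex_mk.aemeasurable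
    hfc.aestronglyMeasurable]
  simp_rw [hf]
  rw [integral_finsetSum _ fun i _ =>
    (integrable_ofReal_pow_mul_pow h4 (hj i) (hk i)).const_mul _]
  simp_rw [integral_const_mul, integral_ofReal_pow_mul_pow]

/-- The value of `κ` comes from `E|z|^4 = 2b + 2 (1/2)^2 = 2 + 2(b - 3/4)`; the moments of `z^2`
vanish because real and imaginary part have equal variance. -/
theorem isStandardEntry_complexEntryLaw {b : ℝ} (hmean : ∫ x, x ∂Q = 0)
    (hvar : variance (fun x : ℝ => x) Q = 1 / 2)
    (hfour_int : Integrable (fun x : ℝ => x ^ 4) Q) (hfour : ∫ x, x ^ 4 ∂Q = b) :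
    IsStandardEntry (complexEntryLaw Q) ((2 * (b - 3 / 4) : ℝ) : ℂ) := by
  have m2 : ∫ x, x ^ 2 ∂Q = 1 / 2 := by
    rw [← hvar, variance_of_integral_eq_zero (by fun_prop) hmean]
  have hmk : ∀ x y : ℝ, (⟨x, y⟩ : ℂ) = x + y * Complex.I := Complex.mk_eq_add_mul_I
  have hcj : ∀ x y : ℝ, (starRingEnd ℂ) (⟨x, y⟩ : ℂ) = x - y * Complex.I := fun x y => by
    rw [hmk]; simp [sub_eq_add_neg]
  have hI := Complex.I_sq
  constructor
  · refine (integrable_map_measure (by fun_prop) measurable_complex_mk.aemeasurable).mpr ?_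
    -- The majorant comes from `(1 + r)^4 ≤ 8(1 + r^4)` and `r^4 ≤ 2(x^4 + y^4)`.
    have hd : Integrable (fun p : ℝ × ℝ => 8 + 16 * p.1 ^ 4 + 16 * p.2 ^ 4) (Q.prod Q) :=
      ((integrable_const _).add ((hfour_int.comp_fst Q).const_mul 16)).add
        ((hfour_int.comp_snd Q).const_mul 16)
    refine hd.mono' ?_ (ae_of_all _ fun p => ?_)
    · exact ((by fun_prop : Continuous fun z : ℂ => (1 + ‖z‖) ^ 4).measurable.comp
        measurable_complex_mk).aestronglyMeasurable
    · simp only [Function.comp]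
      set r := ‖(⟨p.1, p.2⟩ : ℂ)‖ with hr
      have hr0 : 0 ≤ r := norm_nonneg _
      have h2 : r ^ 2 = p.1 ^ 2 + p.2 ^ 2 := by
        rw [hr, Complex.sq_norm, Complex.normSq_mk]; ring
      have h3 : r ^ 4 = (p.1 ^ 2 + p.2 ^ 2) ^ 2 := by rw [← h2]; ring
      rw [Real.norm_of_nonneg (by positivity)]
      have h5 : (1 + r) ^ 4 ≤ 8 * (1 + r ^ 4) := by
        nlinarith [sq_nonneg (r - 1), sq_nonneg (r ^ 2 - 1), sq_nonneg (r * (r - 1))]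
      nlinarith [sq_nonneg (p.1 ^ 2 - p.2 ^ 2)]
  · rw [mixedMoment, integral_complexEntryLaw_eq_sum hfour_int (Finset.univ : Finset (Fin 2))
      ![1, -Complex.I] ![1, 0] ![0, 1] (by decide) (by decide) _ (by fun_prop)]
    · simp [Fin.sum_univ_succ, hmean]
    · intro x y; rw [hcj]; simp [Fin.sum_univ_succ]; ring
  · rw [mixedMoment, integral_complexEntryLaw_eq_sum hfour_int (Finset.univ : Finset (Fin 2))
      ![1, Complex.I] ![1, 0] ![0, 1] (by decide) (by decide) _ (by fun_prop)]
    · simp [Fin.sum_univ_succ, hmean]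
    · intro x y; rw [hmk]; simp [Fin.sum_univ_succ]; ring
  · rw [mixedMoment, integral_complexEntryLaw_eq_sum hfour_int (Finset.univ : Finset (Fin 3))
      ![1, -2 * Complex.I, -1] ![2, 1, 0] ![0, 1, 2] (by decide) (by decide) _ (by fun_prop)]
    · simp [m2, Fin.sum_univ_succ, hmean]
    · intro x y; rw [hcj]; simp [Fin.sum_univ_succ]; linear_combination (y : ℂ) ^ 2 * hI
  · rw [mixedMoment, integral_complexEntryLaw_eq_sum hfour_int (Finset.univ : Finset (Fin 3))
      ![1, 2 * Complex.I, -1] ![2, 1, 0] ![0, 1, 2] (by decide) (by decide) _ (by fun_prop)]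
    · simp [m2, Fin.sum_univ_succ, hmean]
    · intro x y; rw [hmk]; simp [Fin.sum_univ_succ]; linear_combination (y : ℂ) ^ 2 * hI
  · rw [mixedMoment, integral_complexEntryLaw_eq_sum hfour_int (Finset.univ : Finset (Fin 2))
      ![1, 1] ![2, 0] ![0, 2] (by decide) (by decide) _ (by fun_prop)]
    · simp [m2, Fin.sum_univ_succ]; norm_num
    · intro x y; rw [hmk, ← hmk, hcj, hmk]; simp [Fin.sum_univ_succ]
      linear_combination -(y : ℂ) ^ 2 * hI
  · rw [mixedMoment, integral_complexEntryLaw_eq_sum hfour_int (Finset.univ : Finset (Fin 3))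
      ![1, 2, 1] ![4, 2, 0] ![0, 2, 4] (by decide) (by decide) _ (by fun_prop)]
    · simp [m2, hfour, Fin.sum_univ_succ]; ring
    · intro x y
      have : (starRingEnd ℂ) (⟨x, y⟩ : ℂ) * (⟨x, y⟩ : ℂ) = (x : ℂ) ^ 2 + (y : ℂ) ^ 2 := by
        rw [hcj, hmk]; linear_combination -(y : ℂ) ^ 2 * hI
      rw [← mul_pow, this]; simp [Fin.sum_univ_succ]
      ring

theorem map_curry_complexMatrixLaw (n m : ℕ) :
    (complexMatrixLaw Q n m).map (MeasurableEquiv.curry (Fin n) (Fin m) ℂ) =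
      rowsLaw (complexEntryLaw Q) n m := by
  have h := Measure.infinitePi_map_curry (fun (_ : Fin n) (_ : Fin m) => complexEntryLaw Q)
  simp only [Measure.infinitePi_eq_pi] at h
  exact h

theorem secondOrderCorrelation_eq_integral_gramPoly (n m : ℕ) (x y : ℂ) :
    secondOrderCorrelation Q n m x y = ∫ X : Fin n → Fin m → ℂ,
      (gramPoly X).eval x * (gramPoly X).eval y ∂(rowsLaw (complexEntryLaw Q) n m) := by
  rw [← map_curry_complexMatrixLaw, integral_map_equiv, secondOrderCorrelation]
  refine integral_congr_ae (ae_of_all _ fun X => ?_)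
  -- The sign `(-1)^m` between `det(z - X* X)` and `det(X* X - z)` squares to one in the product.
  have e : ∀ z : ℂ, (gramPoly (MeasurableEquiv.curry (Fin n) (Fin m) ℂ X)).eval z = (-1) ^ m *
      ((Matrix.of fun i j => X (i, j))ᴴ * (Matrix.of fun i j => X (i, j)) -
        z • (1 : Matrix (Fin m) (Fin m) ℂ)).det := by
    intro z
    have := Matrix.det_neg ((Matrix.of fun i j => X (i, j))ᴴ * (Matrix.of fun i j => X (i, j)) -
        z • (1 : Matrix (Fin m) (Fin m) ℂ))
    rw [Fintype.card_fin] at this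
    rw [← this, neg_sub, gramPoly, Matrix.eval_charpoly, Matrix.scalar_apply,
      ← Matrix.smul_one_eq_diagonal]
    rfl
  simp only [e]
  rw [mul_mul_mul_comm, ← mul_pow]
  simp

/-- The second-order correlation function as a sum of products of Laguerre polynomials. -/
theorem secondOrderCorrelation_div_factorial {b : ℝ} (hmean : ∫ x, x ∂Q = 0)
    (hvar : variance (fun x : ℝ => x) Q = 1 / 2)
    (hfour_int : Integrable (fun x : ℝ => x ^ 4) Q) (hfour : ∫ x, x ^ 4 ∂Q = b) {n m : ℕ}
    (hmn : m ≤ n) (x y : ℂ) :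
    secondOrderCorrelation Q n m x y / (n ! * m !) =
      ∑ d ∈ Finset.range (m + 1), ((2 * (b - 3 / 4) : ℝ) : ℂ) ^ d / d ! *
        ∑ k ∈ Finset.Ico d (m + 1), laguerreTerm (n - k) (m - k) x y := by
  rw [secondOrderCorrelation_eq_integral_gramPoly,
    (isStandardEntry_complexEntryLaw hmean hvar hfour_int hfour).integral_div_factorial hmn]

end EntryLaw

end

/-! ### Contour integrals for Laguerre polynomials -/

section

open Polynomial

/-- Exchanging the indices costs only a power of `X`. It lets the second Laguerre factor be
represented with the opposite index order, so that the `α`-dependent amplitudes of the two contour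
integrals are reciprocal at the saddle. -/
theorem laguerrePoly_swap (m : ℕ) : ∀ α : ℕ,
    laguerrePoly m (m + α) = X ^ α * laguerrePoly (m + α) m := by
  induction m with
  | zero => intro α; simp [laguerrePoly_zero_left, laguerrePoly_zero_right]
  | succ m ih =>
    intro α
    have h1 := laguerrePoly_succ_succ m (m + α)
    have h2 := laguerrePoly_succ_right (m + α) m
    rw [show m + 1 + α = m + α + 1 by ring, h1, h2, show m + α + 1 = m + (α + 1) by ring, ih,
      ih, smul_eq_C_mul]
    simp only [C_add, C_1]
    push_cast
    rw [show C ((m : ℂ) + (α : ℂ)) = (m : ℂ[X]) + (α : ℂ[X]) by simp]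
    ring

/-- Cauchy's formula for Taylor coefficients over a centered circle. -/
theorem integral_circleMap_mul_inv_pow {f : ℂ → ℂ} (hf : Differentiable ℂ f) {r : ℝ} (hr : 0 < r)
    (m : ℕ) :
    ∫ θ in -Real.pi..Real.pi, f (circleMap 0 r θ) * (circleMap 0 r θ)⁻¹ ^ m =
      2 * Real.pi / m ! * iteratedDeriv m f 0 := by
  have hper : Function.Periodic (fun θ => f (circleMap 0 r θ) * (circleMap 0 r θ)⁻¹ ^ m)
      (2 * Real.pi) := fun θ => by simp only [periodic_circleMap 0 r θ]
  have h1 := hper.intervalIntegral_add_eq (-Real.pi) 0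
  rw [show -Real.pi + 2 * Real.pi = Real.pi by ring, zero_add] at h1
  have h2 := hf.diffContOnCl.circleIntegral_one_div_sub_center_pow_smul (c := 0) hr m
  rw [circleIntegral_def_Icc] at h2
  rw [h1, intervalIntegral.integral_of_le (by positivity), ← integral_Icc_eq_integral_Ioc]
  have h3 : ∫ θ in Set.Icc 0 (2 * Real.pi), deriv (circleMap 0 r) θ •
      (fun z => (1 / (z - 0) ^ (m + 1)) • f z) (circleMap 0 r θ) =
      Complex.I * ∫ θ in Set.Icc 0 (2 * Real.pi),
        f (circleMap 0 r θ) * (circleMap 0 r θ)⁻¹ ^ m := by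
    rw [← integral_const_mul]
    refine integral_congr_ae (ae_of_all _ fun θ => ?_)
    have hne : circleMap 0 r θ ≠ 0 := circleMap_ne_center hr.ne'
    simp only [deriv_circleMap, sub_zero, smul_eq_mul, inv_pow, pow_succ]
    field_simp
  have h4 := h3.symm.trans h2
  apply mul_left_cancel₀ Complex.I_ne_zero
  rw [h4, smul_eq_mul]
  ring

/-- Since `1 - d/dx` acts on `e^{xt}` as multiplication by `1 - t`, `L_{n,m}(x) / m!` is the
coefficient of `t^m` in `(1 - t)^n e^{xt}`. -/
theorem laguerrePoly_eval_eq_integral {r : ℝ} (hr : 0 < r) (x : ℂ) (n : ℕ) : ∀ m : ℕ,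
    ∫ θ in -Real.pi..Real.pi, (1 - circleMap 0 r θ) ^ n * Complex.exp (x * circleMap 0 r θ) *
        (circleMap 0 r θ)⁻¹ ^ m =
      2 * Real.pi * ((laguerrePoly n m).eval x / m !) := by
  have hne : ∀ θ, circleMap 0 r θ ≠ 0 := fun θ => circleMap_ne_center hr.ne'
  have hint : ∀ n m : ℕ, IntervalIntegrable (fun θ => (1 - circleMap 0 r θ) ^ n *
      Complex.exp (x * circleMap 0 r θ) * (circleMap 0 r θ)⁻¹ ^ m) volume (-Real.pi) Real.pi := by
    intro n m
    refine Continuous.intervalIntegrable ?_ _ _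
    have : Continuous fun θ => (circleMap 0 r θ)⁻¹ := (continuous_circleMap 0 r).inv₀ hne
    fun_prop
  induction n with
  | zero =>
    intro m
    have h := integral_circleMap_mul_inv_pow (f := fun z => Complex.exp (x * z))
      (by fun_prop) hr m
    simp only [pow_zero, one_mul]
    rw [h, iteratedDeriv_cexp_const_mul, laguerrePoly_zero_left]
    simp
    ring
  | succ n ih =>
    intro m
    cases m with
    | zero =>
      have h := integral_circleMap_mul_inv_pow
        (f := fun z => (1 - z) ^ (n + 1) * Complex.exp (x * z)) (by fun_prop) hr 0
      rw [h, laguerrePoly_zero_right]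
      simp
    | succ m =>
      have e : ∀ θ, (1 - circleMap 0 r θ) ^ (n + 1) * Complex.exp (x * circleMap 0 r θ) *
          (circleMap 0 r θ)⁻¹ ^ (m + 1) =
          (1 - circleMap 0 r θ) ^ n * Complex.exp (x * circleMap 0 r θ) *
            (circleMap 0 r θ)⁻¹ ^ (m + 1) -
          (1 - circleMap 0 r θ) ^ n * Complex.exp (x * circleMap 0 r θ) *
            (circleMap 0 r θ)⁻¹ ^ m := by
        intro θ
        have := hne θ
        rw [pow_succ _ n, pow_succ _ m]
        field_simp
      simp_rw [e]
      rw [intervalIntegral.integral_sub (hint _ _) (hint _ _), ih, ih, laguerrePoly_succ_succ,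
        eval_sub, eval_smul, Nat.factorial_succ, smul_eq_mul]
      have : (m ! : ℂ) ≠ 0 := by exact_mod_cast m.factorial_ne_zero
      have : (m + 1 : ℂ) ≠ 0 := by exact_mod_cast m.succ_ne_zero
      push_cast
      field_simp

/-- The point `exp (-ε (1 + i u)) / 2` of the circle of radius `exp (-ε) / 2`. -/
noncomputable def edgeCircle (ε u : ℝ) : ℂ := Complex.exp (-(ε * (1 + u * Complex.I))) / 2

theorem edgeCircle_eq_circleMap (ε u : ℝ) :
    edgeCircle ε u = circleMap 0 (Real.exp (-ε) / 2) (-ε * u) := by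
  rw [edgeCircle, circleMap, zero_add]
  push_cast
  rw [div_mul_eq_mul_div, ← Complex.exp_add]
  congr 2
  ring

/-- The integrand of the rescaled contour integral for Laguerre polynomials at the soft edge. -/
noncomputable def edgeIntegrand (ε : ℝ) (n : ℕ) (x : ℝ) (u : ℝ) : ℂ :=
  (2 * Complex.exp (ε * (1 + u * Complex.I)) - 1) ^ n *
    Complex.exp (x * ((Complex.exp (-(ε * (1 + u * Complex.I))) - 1) / 2))

/-- The rescaled contour integral for Laguerre polynomials at the soft edge. -/
noncomputable def edgeIntegral (g : ℂ → ℂ) (ε : ℝ) (n : ℕ) (x : ℝ) : ℂ :=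
  1 / (2 * Real.pi) * ∫ u in (-(Real.pi / ε))..Real.pi / ε,
    edgeIntegrand ε n x u * g (edgeCircle ε u)

/-- Substituting `θ = -εu` turns the circle into the segment `s = ε(1 + iu)`, on which `(1 - t)/t =
2e^s - 1`. The minus sign gives `t = e^{-s}/2` and reverses the orientation. The amplitude `g`
collects the powers outside `((1 - t)/t)^k`. -/
theorem laguerrePoly_eval_eq_edgeIntegral {ε : ℝ} (hε : 0 < ε) (x : ℝ) (n m : ℕ) (g : ℂ → ℂ)
    (k : ℕ) (hg : ∀ u, (1 - edgeCircle ε u) ^ n * (edgeCircle ε u)⁻¹ ^ m =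
      ((1 - edgeCircle ε u) / edgeCircle ε u) ^ k * g (edgeCircle ε u)) :
    (laguerrePoly n m).eval (x : ℂ) / m ! =
      Complex.exp (x / 2) * (ε * edgeIntegral g ε k x) := by
  have h := laguerrePoly_eval_eq_integral (r := Real.exp (-ε) / 2) (by positivity) x n m
  have hsub := intervalIntegral.integral_comp_mul_left (a := Real.pi / ε) (b := -(Real.pi / ε))
    (fun θ => (1 - circleMap 0 (Real.exp (-ε) / 2) θ) ^ n *
      Complex.exp (x * circleMap 0 (Real.exp (-ε) / 2) θ) *
        (circleMap 0 (Real.exp (-ε) / 2) θ)⁻¹ ^ m) (neg_ne_zero.mpr hε.ne')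
  rw [show -ε * (Real.pi / ε) = -Real.pi by field_simp,
    show -ε * -(Real.pi / ε) = Real.pi by field_simp, h] at hsub
  simp_rw [← edgeCircle_eq_circleMap] at hsub
  have e : ∀ u, (1 - edgeCircle ε u) ^ n * Complex.exp (x * edgeCircle ε u) *
      (edgeCircle ε u)⁻¹ ^ m =
      Complex.exp (x / 2) * (edgeIntegrand ε k x u * g (edgeCircle ε u)) := by
    intro u
    have h1 : (1 - edgeCircle ε u) / edgeCircle ε u =
        2 * Complex.exp (ε * (1 + u * Complex.I)) - 1 := by
      have := Complex.exp_ne_zero (ε * (1 + u * Complex.I))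
      rw [edgeCircle, Complex.exp_neg]
      field_simp
    rw [mul_right_comm, hg, h1, edgeIntegrand]
    have h2 : Complex.exp (x * edgeCircle ε u) = Complex.exp (x / 2) *
        Complex.exp (x * ((Complex.exp (-(ε * (1 + u * Complex.I))) - 1) / 2)) := by
      rw [← Complex.exp_add, edgeCircle]
      congr 1
      ring
    rw [h2]
    ring
  simp_rw [e, intervalIntegral.integral_const_mul] at hsub
  rw [intervalIntegral.integral_symm, Complex.real_smul] at hsub
  rw [edgeIntegral]
  have hpi : (Real.pi : ℂ) ≠ 0 := by exact_mod_cast Real.pi_ne_zero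
  have hεc : (ε : ℂ) ≠ 0 := by exact_mod_cast hε.ne'
  push_cast at hsub
  field_simp at hsub ⊢
  linear_combination hsub

end

/-! ### The phase at the double saddle and Gaussian domination -/

section

open Complex Asymptotics

/-- The phase function at the soft edge. -/
noncomputable def edgePhase (s : ℂ) : ℂ := log (2 * exp s - 1) + 2 * (exp (-s) - 1)

theorem eventually_two_mul_exp_sub_one_mem_slitPlane :
    ∀ᶠ s : ℂ in 𝓝 0, 2 * exp s - 1 ∈ slitPlane := by
  have h : ContinuousAt (fun s : ℂ => 2 * exp s - 1) 0 := by fun_prop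
  refine h.eventually (isOpen_slitPlane.mem_nhds ?_)
  simp
  norm_num [mem_slitPlane_iff]

theorem hasDerivAt_log_two_mul_exp_sub_one {s : ℂ} (hs : 2 * exp s - 1 ∈ slitPlane) :
    HasDerivAt (fun s => log (2 * exp s - 1)) (2 * exp s / (2 * exp s - 1)) s :=
  (((hasDerivAt_exp s).const_mul 2).sub_const 1).clog hs

theorem exp_sub_one_eq (s : ℂ) : exp s - 1 = s * dslope exp 0 s := by
  have := sub_smul_dslope exp (0 : ℂ) s
  simpa [eq_comm] using this

/-- The derivative is `2e^{-s}(e^s - 1)^2 / (2e^s - 1)`; writing `e^s - 1 = s * dslope exp 0 s`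
exhibits the double zero at `0`. -/
theorem hasDerivAt_edgePhase {s : ℂ} (hs : 2 * exp s - 1 ∈ slitPlane) :
    HasDerivAt edgePhase (s ^ 2 * (2 * exp (-s) * dslope exp 0 s ^ 2 / (2 * exp s - 1))) s := by
  have h1 := (hasDerivAt_log_two_mul_exp_sub_one hs).add
    (((((hasDerivAt_neg s).cexp)).sub_const 1).const_mul 2)
  refine h1.congr_deriv ?_
  have h0 : 2 * exp s - 1 ≠ 0 := slitPlane_ne_zero hs
  have h2 : s ^ 2 * (2 * exp (-s) * dslope exp 0 s ^ 2 / (2 * exp s - 1)) =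
      2 * exp (-s) * (s * dslope exp 0 s) ^ 2 / (2 * exp s - 1) := by ring
  rw [h2, ← exp_sub_one_eq, exp_neg]
  have := exp_ne_zero s
  field_simp
  ring

/-- The derivative differs from `2s^2` by `o(s^2)`; the mean value inequality on the ball of radius
`‖s‖` integrates this to `o(s^3)`. -/
theorem edgePhase_isLittleO :
    (fun s => edgePhase s - 2 / 3 * s ^ 3) =o[𝓝 0] fun s : ℂ => s ^ 3 := by
  have hw : Tendsto (fun s : ℂ => 2 * exp (-s) * dslope exp 0 s ^ 2 / (2 * exp s - 1) - 2) (𝓝 0)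
      (𝓝 0) := by
    have hd : ContinuousAt (dslope exp (0 : ℂ)) 0 :=
      continuousAt_dslope_same.mpr differentiableAt_exp
    have hc : ContinuousAt
        (fun s : ℂ => 2 * exp (-s) * dslope exp 0 s ^ 2 / (2 * exp s - 1) - 2) 0 := by
      refine ContinuousAt.sub (ContinuousAt.div (by fun_prop) (by fun_prop) ?_) continuousAt_const
      simp; norm_num
    have := hc.tendsto
    simpa [show (2 : ℂ) - 1 = 1 by norm_num] using this
  rw [isLittleO_iff]
  intro η hη
  have hev := (hw.eventually (Metric.ball_mem_nhds 0 hη)).and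
    eventually_two_mul_exp_sub_one_mem_slitPlane
  obtain ⟨δ, hδ, hball⟩ := Metric.eventually_nhds_iff_ball.mp hev
  filter_upwards [Metric.ball_mem_nhds (0 : ℂ) hδ] with s hs
  have hs' : ‖s‖ < δ := by simpa using hs
  have hsub : ∀ z ∈ Metric.closedBall (0 : ℂ) ‖s‖, z ∈ Metric.ball (0 : ℂ) δ := fun z hz => by
    simp at hz ⊢; linarith
  have hmv := (convex_closedBall (0 : ℂ) ‖s‖).norm_image_sub_le_of_norm_hasDerivWithin_le
    (f := fun s => edgePhase s - 2 / 3 * s ^ 3) (C := η * ‖s‖ ^ 2)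
    (f' := fun z => z ^ 2 * (2 * exp (-z) * dslope exp 0 z ^ 2 / (2 * exp z - 1)) - 2 * z ^ 2)
    (x := 0) (y := s) (fun z hz => ?_) (fun z hz => ?_) (by simp) (by simp)
  · have h0 : edgePhase 0 = 0 := by
      simp [edgePhase, show (2 : ℂ) - 1 = 1 by norm_num]
    simp only [h0, sub_zero, ne_eq, OfNat.ofNat_ne_zero, not_false_eq_true, zero_pow, mul_zero]
      at hmv
    rw [norm_pow]
    linarith [show η * ‖s‖ ^ 2 * ‖s‖ = η * ‖s‖ ^ 3 by ring]
  · have hp : HasDerivAt (fun s : ℂ => 2 / 3 * s ^ 3) (2 * z ^ 2) z := by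
      refine ((hasDerivAt_pow 3 z).const_mul (2 / 3 : ℂ)).congr_deriv ?_
      push_cast; ring
    exact ((hasDerivAt_edgePhase (hball z (hsub z hz)).2).sub hp).hasDerivWithinAt
  · have h1 := (hball z (hsub z hz)).1
    rw [dist_zero_right] at h1
    rw [show z ^ 2 * (2 * exp (-z) * dslope exp 0 z ^ 2 / (2 * exp z - 1)) - 2 * z ^ 2 =
      (2 * exp (-z) * dslope exp 0 z ^ 2 / (2 * exp z - 1) - 2) * z ^ 2 by ring, norm_mul, norm_pow]
    have hz' : ‖z‖ ≤ ‖s‖ := by simpa using hz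
    gcongr

/-- The rescaled phase converges to the Airy phase. -/
theorem tendsto_edgePhase_div (z : ℂ) :
    Tendsto (fun ε : ℝ => edgePhase (ε * z) / (2 * (ε : ℂ) ^ 3)) (𝓝[>] 0) (𝓝 (z ^ 3 / 3)) := by
  have hlin : Tendsto (fun ε : ℝ => (ε : ℂ) * z) (𝓝[>] 0) (𝓝 0) := by
    have : Continuous fun ε : ℝ => (ε : ℂ) * z := by fun_prop
    have := this.tendsto 0
    simp only [ofReal_zero, zero_mul] at this
    exact this.mono_left nhdsWithin_le_nhds
  have h1 := (edgePhase_isLittleO.comp_tendsto hlin)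
  have h2 : (fun ε : ℝ => ((ε : ℂ) * z) ^ 3) =O[𝓝[>] 0] fun ε : ℝ => (ε : ℂ) ^ 3 := by
    refine IsBigO.of_bound (‖z‖ ^ 3) (Eventually.of_forall fun ε => ?_)
    rw [mul_pow, norm_mul, norm_pow, norm_pow]; linarith [mul_comm (‖(ε : ℂ)‖ ^ 3) (‖z‖ ^ 3)]
  have h3 := (h1.trans_isBigO h2).tendsto_div_nhds_zero
  have h4 := (h3.div_const 2).add_const (z ^ 3 / 3)
  rw [zero_div, zero_add] at h4
  refine h4.congr' ?_
  filter_upwards [self_mem_nhdsWithin] with ε hε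
  have : (ε : ℂ) ≠ 0 := by exact_mod_cast (ne_of_gt hε)
  simp only [Function.comp]
  field_simp
  ring

theorem tendsto_comp_mul_div {f : ℂ → ℂ} {c : ℂ} (hf : HasDerivAt f c 0) (h0 : f 0 = 0) (z : ℂ) :
    Tendsto (fun ε : ℝ => f (ε * z) / ε) (𝓝[>] 0) (𝓝 (c * z)) := by
  have h1 : HasDerivAt (fun ε : ℝ => f (ε * z)) (c * z) 0 := by
    have hl : HasDerivAt (fun ε : ℝ => (ε : ℂ) * z) z 0 := by
      simpa using (hasDerivAt_id (0 : ℝ)).ofReal_comp.mul_const z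
    have : HasDerivAt f c ((fun ε : ℝ => (ε : ℂ) * z) 0) := by simpa using hf
    exact this.comp (0 : ℝ) hl
  have h2 := h1.tendsto_slope_zero_right
  refine h2.congr fun ε => ?_
  rw [zero_add, ofReal_zero, zero_mul, h0, sub_zero, real_smul, ofReal_inv, div_eq_inv_mul]

theorem tendsto_log_div (z : ℂ) :
    Tendsto (fun ε : ℝ => log (2 * exp (ε * z) - 1) / ε) (𝓝[>] 0) (𝓝 (2 * z)) := by
  have h := hasDerivAt_log_two_mul_exp_sub_one (s := 0)
    eventually_two_mul_exp_sub_one_mem_slitPlane.self_of_nhds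
  rw [exp_zero, show (2 * 1 / (2 * 1 - 1) : ℂ) = 2 by norm_num] at h
  exact tendsto_comp_mul_div h (by simp [show (2 : ℂ) - 1 = 1 by norm_num]) z

theorem tendsto_exp_neg_sub_one_div (z : ℂ) :
    Tendsto (fun ε : ℝ => (exp (-(ε * z)) - 1) / ε) (𝓝[>] 0) (𝓝 (-z)) := by
  have h := ((hasDerivAt_neg (0 : ℂ)).cexp).sub_const 1
  rw [neg_zero, exp_zero, one_mul] at h
  simpa using tendsto_comp_mul_div h (by simp) z

/-- The integrand as the exponential of a phase. -/
theorem edgeIntegrand_eq_exp {ε μ : ℝ} (hε : 0 < ε) {N j : ℕ} (hN : 2 * N * ε ^ 3 = 1) (hj : j ≤ N)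
    (u : ℝ) (hs : 2 * exp (ε * (1 + u * I)) - 1 ≠ 0) :
    edgeIntegrand ε (N - j) (2 / ε ^ 3 + 2 * μ / ε) u =
      exp (edgePhase (ε * (1 + u * I)) / (2 * (ε : ℂ) ^ 3) -
        (2 * ε * j : ℝ) / 2 * (log (2 * exp (ε * (1 + u * I)) - 1) / ε) +
        μ * ((exp (-(ε * (1 + u * I))) - 1) / ε)) := by
  have hεc : (ε : ℂ) ≠ 0 := by exact_mod_cast hε.ne'
  have hNc : (N : ℂ) = 1 / (2 * (ε : ℂ) ^ 3) := by
    rw [eq_div_iff (mul_ne_zero two_ne_zero (pow_ne_zero 3 hεc))]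
    have : ((2 * N * ε ^ 3 : ℝ) : ℂ) = 1 := by rw [hN]; simp
    push_cast at this
    linear_combination this
  rw [edgeIntegrand]
  nth_rewrite 1 [← exp_log hs]
  rw [← exp_nat_mul, ← exp_add, Nat.cast_sub hj, hNc, edgePhase]
  congr 1
  push_cast
  field_simp
  ring

/-- The exponent has three limits for `z = 1 + iu`: the phase gives `z^3/3`, the offset `μ` gives
`-μz`, and the `j` missing factors give `-σz`, since `log(2e^{εz} - 1) ~ 2εz`. Lowering the index
thus shifts the Airy argument. -/
theorem tendsto_edgeIntegrand {ι : Type*} {l : Filter ι} {ε : ι → ℝ} {N j : ι → ℕ} {μ σ : ℝ}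
    (hε : Tendsto ε l (𝓝[>] 0)) (hN : ∀ᶠ i in l, 2 * N i * ε i ^ 3 = 1) (hj : ∀ᶠ i in l, j i ≤ N i)
    (hσ : Tendsto (fun i => 2 * ε i * j i) l (𝓝 σ)) (u : ℝ) :
    Tendsto (fun i => edgeIntegrand (ε i) (N i - j i) (2 / ε i ^ 3 + 2 * μ / ε i) u) l
      (𝓝 (exp ((1 + u * I) ^ 3 / 3 - (μ + σ : ℝ) * (1 + u * I)))) := by
  have h1 := ((tendsto_edgePhase_div (1 + u * I)).comp hε).sub
    (((continuous_ofReal.tendsto σ).comp hσ).div_const 2 |>.mul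
      ((tendsto_log_div (1 + u * I)).comp hε)) |>.add
      (((tendsto_exp_neg_sub_one_div (1 + u * I)).comp hε).const_mul (μ : ℂ))
  have h2 := (continuous_exp.tendsto _).comp h1
  have hlin : Tendsto (fun i => (ε i : ℂ) * (1 + u * I)) l (𝓝 0) := by
    have : Continuous fun ε : ℝ => (ε : ℂ) * (1 + u * I) := by fun_prop
    have := this.tendsto 0
    simp only [ofReal_zero, zero_mul] at this
    exact (this.mono_left nhdsWithin_le_nhds).comp hε
  rw [show (1 + (u : ℂ) * I) ^ 3 / 3 - (μ + σ : ℝ) * (1 + u * I) =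
    (1 + u * I) ^ 3 / 3 - (σ : ℂ) / 2 * (2 * (1 + u * I)) + μ * -(1 + u * I) by push_cast; ring]
  refine h2.congr' ?_
  filter_upwards [hε self_mem_nhdsWithin, hN, hj,
    hlin eventually_two_mul_exp_sub_one_mem_slitPlane] with i hi hNi hji hsi
  exact (edgeIntegrand_eq_exp hi hNi hji u (slitPlane_ne_zero hsi)).symm

theorem norm_sq_two_mul_exp_sub_one (ε u : ℝ) :
    ‖2 * exp (ε * (1 + u * I)) - 1‖ ^ 2 =
      (2 * Real.exp ε - 1) ^ 2 + 4 * Real.exp ε * (1 - Real.cos (ε * u)) := by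
  have e : (ε : ℂ) * (1 + u * I) = ε + (ε * u : ℝ) * I := by push_cast; ring
  have e2 : 2 * exp (ε * (1 + u * I)) - 1 = (2 * Real.exp ε * Real.cos (ε * u) - 1 : ℝ) +
      (2 * Real.exp ε * Real.sin (ε * u) : ℝ) * I := by
    rw [e, exp_add_mul_I]; push_cast; ring
  rw [Complex.sq_norm, e2, normSq_add_mul_I]
  linear_combination 4 * Real.exp ε ^ 2 * Real.sin_sq_add_cos_sq (ε * u)

theorem norm_edgeIntegrand (ε : ℝ) (n : ℕ) (x u : ℝ) :
    ‖edgeIntegrand ε n x u‖ = ‖2 * exp (ε * (1 + u * I)) - 1‖ ^ n *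
      Real.exp (x * (((Real.exp ε)⁻¹ * Real.cos (ε * u) - 1) / 2)) := by
  rw [edgeIntegrand, norm_mul, norm_pow, norm_exp]
  congr 2
  have e : -((ε : ℂ) * (1 + u * I)) = (-ε : ℝ) + (-(ε * u) : ℝ) * I := by push_cast; ring
  have e2 : x * ((exp (-(ε * (1 + u * I))) - 1) / 2) =
      (x * (((Real.exp ε)⁻¹ * Real.cos (ε * u) - 1) / 2) : ℝ) +
      (-(x * ((Real.exp ε)⁻¹ * Real.sin (ε * u) / 2)) : ℝ) * I := by
    rw [e, exp_add_mul_I, ← Real.exp_neg]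
    push_cast
    rw [Complex.cos_neg, Complex.sin_neg]
    ring
  rw [e2, add_re, ofReal_re, re_ofReal_mul, I_re, mul_zero, add_zero]

/-- `1 + y ≤ e^y` puts the growth away from `u = 0` into the form `exp(C(1 - cos))`, the same form
as the decay of the exponential factor, so that only coefficients must be compared. -/
theorem norm_two_mul_exp_sub_one_le (ε u : ℝ) (hε : 0 ≤ ε) :
    ‖2 * exp (ε * (1 + u * I)) - 1‖ ≤ (2 * Real.exp ε - 1) *
      Real.exp (2 * Real.exp ε * (1 - Real.cos (ε * u)) / (2 * Real.exp ε - 1) ^ 2) := by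
  have ha : 1 ≤ Real.exp ε := Real.one_le_exp hε
  set a := Real.exp ε
  have h2 : 0 < 2 * a - 1 := by linarith
  refine le_of_sq_le_sq ?_ (by positivity)
  rw [norm_sq_two_mul_exp_sub_one, mul_pow, ← Real.exp_nat_mul]
  have := Real.add_one_le_exp (((2 : ℕ) : ℝ) *
    (2 * a * (1 - Real.cos (ε * u)) / (2 * a - 1) ^ 2))
  refine le_trans (le_of_eq ?_) (mul_le_mul_of_nonneg_left this (by positivity))
  field_simp
  push_cast
  ring

/-- This is the net coefficient of `1 - cos(εu)`, decay minus growth. The two contributions of order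
`ε^{-3}` cancel at `e^ε = 1`, so what survives is at least `ε^{-2}`; half of it is given up to
absorb the `μ` term. -/
theorem le_edge_coefficient {ε μ : ℝ} (hε : 0 < ε) (ha : Real.exp ε ≤ 11 / 10)
    (hμ : |μ| * ε ≤ 1 / 2) :
    1 / (2 * ε ^ 2) ≤ (2 / ε ^ 3 + 2 * μ / ε) / (2 * Real.exp ε) -
      1 / ε ^ 3 * Real.exp ε / (2 * Real.exp ε - 1) ^ 2 := by
  have h1 : ε + 1 ≤ Real.exp ε := Real.add_one_le_exp ε
  set a := Real.exp ε
  have h2 : 0 < 2 * a - 1 := by linarith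
  have ha0 : 0 < a := by linarith
  have key : ε ≤ 1 / a - a / (2 * a - 1) ^ 2 := by
    have : a - 1 ≤ 1 / a - a / (2 * a - 1) ^ 2 := by
      rw [div_sub_div _ _ (by positivity) (by positivity), le_div_iff₀ (by positivity)]
      -- Since `(2a - 1)^2 - a^2 = (a - 1)(3a - 1)`, the claim reduces to this inequality on `1 ≤ a
      -- ≤ 11/10`.
      have hq : a * (2 * a - 1) ^ 2 ≤ 3 * a - 1 := by
        nlinarith [mul_nonneg (sub_nonneg.mpr ha) (show (0 : ℝ) ≤ a - 1 by linarith)]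
      nlinarith [mul_le_mul_of_nonneg_left hq (show (0 : ℝ) ≤ a - 1 by linarith)]
    linarith
  have hμ' : -(1 / (2 * ε ^ 2)) ≤ μ / (ε * a) := by
    have h3 : |μ / (ε * a)| ≤ 1 / (2 * ε ^ 2) := by
      rw [abs_div, abs_of_pos (show 0 < ε * a by positivity), div_le_div_iff₀ (by positivity)
        (by positivity)]
      nlinarith [mul_le_mul_of_nonneg_right hμ hε.le, abs_nonneg μ]
    exact (abs_le.mp h3).1
  have h4 : ε * (1 / ε ^ 3) ≤ (1 / a - a / (2 * a - 1) ^ 2) * (1 / ε ^ 3) :=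
    mul_le_mul_of_nonneg_right key (by positivity)
  have e1 : ε * (1 / ε ^ 3) = 1 / (2 * ε ^ 2) + 1 / (2 * ε ^ 2) := by field_simp; norm_num
  have e2 : (2 / ε ^ 3 + 2 * μ / ε) / (2 * a) - 1 / ε ^ 3 * a / (2 * a - 1) ^ 2 =
      (1 / a - a / (2 * a - 1) ^ 2) * (1 / ε ^ 3) + μ / (ε * a) := by
    field_simp
    ring
  rw [e2]
  linarith

/-- The Gaussian bound for the rescaled integrand at the soft edge. -/
theorem eventually_norm_edgeIntegrand_le (μ : ℝ) : ∃ c : ℝ, 0 ≤ c ∧ ∀ᶠ ε : ℝ in 𝓝[>] 0,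
    ∀ N j : ℕ, 2 * N * ε ^ 3 = 1 → j ≤ N → ∀ u : ℝ, |ε * u| ≤ Real.pi →
      ‖edgeIntegrand ε (N - j) (2 / ε ^ 3 + 2 * μ / ε) u‖ ≤
        c * Real.exp (-(ε * j)) * Real.exp (-(1 / Real.pi ^ 2 * u ^ 2)) := by
  have h1 := (((tendsto_edgePhase_div (1 + (0 : ℝ) * I)).add
      ((tendsto_exp_neg_sub_one_div (1 + (0 : ℝ) * I)).const_mul (μ : ℂ))).cexp).norm
  have h2 := h1.eventually_lt_const (lt_add_one _)
  refine ⟨‖exp ((1 + ((0 : ℝ) : ℂ) * I) ^ 3 / 3 + μ * -(1 + ((0 : ℝ) : ℂ) * I))‖ + 1,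
    by positivity, ?_⟩
  have hcont : ∀ {f : ℝ → ℝ} {b : ℝ}, Continuous f → f 0 < b → ∀ᶠ ε in 𝓝[>] 0, f ε < b :=
    fun hf hb => (hf.tendsto 0).mono_left nhdsWithin_le_nhds |>.eventually_lt_const hb
  have h3 := hcont (f := Real.exp) (b := 11 / 10) Real.continuous_exp (by norm_num)
  have h4 := hcont (f := fun ε => |μ| * ε) (b := 1 / 2) (by fun_prop) (by norm_num)
  filter_upwards [h2, h3, h4, self_mem_nhdsWithin] with ε h2 h3 h4 hε N j hN hj u hu
  have hε : 0 < ε := hε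
  have hNr : (N : ℝ) = 1 / (2 * ε ^ 3) := by
    rw [eq_div_iff (by positivity)]; linarith
  have ha : 1 ≤ Real.exp ε := Real.one_le_exp hε.le
  -- The left side is the modulus of the integrand with `j = 0` at `u = 0`, which converges; the
  -- constant is the modulus of its limit plus one.
  have hbase : (2 * Real.exp ε - 1) ^ N *
      Real.exp ((2 / ε ^ 3 + 2 * μ / ε) * (((Real.exp ε)⁻¹ - 1) / 2)) ≤
      ‖exp ((1 + ((0 : ℝ) : ℂ) * I) ^ 3 / 3 + μ * -(1 + ((0 : ℝ) : ℂ) * I))‖ + 1 := by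
    have hne : 2 * exp (ε * (1 + ((0 : ℝ) : ℂ) * I)) - 1 ≠ 0 := by
      rw [ofReal_zero, zero_mul, add_zero, mul_one, ← ofReal_exp]
      have : (2 * Real.exp ε - 1 : ℝ) ≠ 0 := by linarith
      exact_mod_cast this
    have e : edgeIntegrand ε N (2 / ε ^ 3 + 2 * μ / ε) 0 =
        exp (edgePhase (ε * (1 + ((0 : ℝ) : ℂ) * I)) / (2 * (ε : ℂ) ^ 3) +
          μ * ((exp (-(ε * (1 + ((0 : ℝ) : ℂ) * I))) - 1) / ε)) := by
      simpa using edgeIntegrand_eq_exp (μ := μ) hε hN (Nat.zero_le N) 0 hne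
    have e2 := norm_edgeIntegrand ε N (2 / ε ^ 3 + 2 * μ / ε) 0
    rw [e] at e2
    have e3 : ‖2 * exp (ε * (1 + ((0 : ℝ) : ℂ) * I)) - 1‖ = 2 * Real.exp ε - 1 := by
      rw [ofReal_zero, zero_mul, add_zero, mul_one, ← ofReal_exp]
      have : (2 : ℂ) * (Real.exp ε : ℝ) - 1 = ((2 * Real.exp ε - 1 : ℝ) : ℂ) := by push_cast; rfl
      rw [this, norm_real, Real.norm_of_nonneg (by linarith)]
    rw [e3, mul_zero, Real.cos_zero, mul_one] at e2
    rw [← e2]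
    exact h2.le
  set a := Real.exp ε with hadef
  have h5 : 0 < 2 * a - 1 := by linarith
  set w := ‖2 * exp (ε * (1 + u * I)) - 1‖ with hw
  have hcos : 0 ≤ 1 - Real.cos (ε * u) := by linarith [Real.cos_le_one (ε * u)]
  -- The modulus is at least `2e^ε - 1 ≥ e^ε`, so each of the `j` dropped factors gains `e^{-ε}`.
  have hwa : a ≤ w := by
    refine le_of_sq_le_sq ?_ (norm_nonneg _)
    rw [hw, norm_sq_two_mul_exp_sub_one, ← hadef]
    have : 0 ≤ 4 * a * (1 - Real.cos (ε * u)) := by positivity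
    nlinarith
  have hw0 : 0 < w := by linarith
  have hpow : w ^ (N - j) ≤ w ^ N * Real.exp (-(ε * j)) := by
    rw [pow_sub₀ _ hw0.ne' hj, Real.exp_neg]
    refine mul_le_mul_of_nonneg_left ?_ (by positivity)
    refine inv_anti₀ (Real.exp_pos _) ?_
    rw [mul_comm ε, Real.exp_nat_mul]
    exact pow_le_pow_left₀ (by linarith) hwa j
  have hwN : w ^ N ≤ (2 * a - 1) ^ N *
      Real.exp (1 / ε ^ 3 * a / (2 * a - 1) ^ 2 * (1 - Real.cos (ε * u))) := by
    refine (pow_le_pow_left₀ hw0.le (norm_two_mul_exp_sub_one_le ε u hε.le) N).trans_eq ?_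
    rw [mul_pow, ← Real.exp_nat_mul, hNr, ← hadef]
    congr 2
    field_simp
  have hx : (2 / ε ^ 3 + 2 * μ / ε) * ((a⁻¹ * Real.cos (ε * u) - 1) / 2) =
      (2 / ε ^ 3 + 2 * μ / ε) * ((a⁻¹ - 1) / 2) -
        (2 / ε ^ 3 + 2 * μ / ε) / (2 * a) * (1 - Real.cos (ε * u)) := by
    field_simp
    ring
  rw [norm_edgeIntegrand, ← hw, ← hadef, hx, sub_eq_add_neg, Real.exp_add]
  calc w ^ (N - j) * (Real.exp ((2 / ε ^ 3 + 2 * μ / ε) * ((a⁻¹ - 1) / 2)) *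
        Real.exp (-((2 / ε ^ 3 + 2 * μ / ε) / (2 * a) * (1 - Real.cos (ε * u)))))
      ≤ ((2 * a - 1) ^ N *
          Real.exp (1 / ε ^ 3 * a / (2 * a - 1) ^ 2 * (1 - Real.cos (ε * u))) *
            Real.exp (-(ε * j))) * (Real.exp ((2 / ε ^ 3 + 2 * μ / ε) * ((a⁻¹ - 1) / 2)) *
        Real.exp (-((2 / ε ^ 3 + 2 * μ / ε) / (2 * a) * (1 - Real.cos (ε * u))))) := by
        refine mul_le_mul_of_nonneg_right (hpow.trans ?_) (by positivity)
        exact mul_le_mul_of_nonneg_right hwN (Real.exp_pos _).le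
    _ = ((2 * a - 1) ^ N * Real.exp ((2 / ε ^ 3 + 2 * μ / ε) * ((a⁻¹ - 1) / 2))) *
          Real.exp (-(ε * j)) * Real.exp (-(((2 / ε ^ 3 + 2 * μ / ε) / (2 * a) -
            1 / ε ^ 3 * a / (2 * a - 1) ^ 2) * (1 - Real.cos (ε * u)))) := by
        rw [show -(((2 / ε ^ 3 + 2 * μ / ε) / (2 * a) - 1 / ε ^ 3 * a / (2 * a - 1) ^ 2) *
            (1 - Real.cos (ε * u))) = 1 / ε ^ 3 * a / (2 * a - 1) ^ 2 * (1 - Real.cos (ε * u)) +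
            -((2 / ε ^ 3 + 2 * μ / ε) / (2 * a) * (1 - Real.cos (ε * u))) by ring, Real.exp_add]
        ring
    _ ≤ _ := by
        refine mul_le_mul (mul_le_mul_of_nonneg_right hbase (Real.exp_pos _).le) ?_
          (Real.exp_pos _).le (by positivity)
        refine Real.exp_le_exp.mpr (neg_le_neg ?_)
        -- `1 - cos θ ≥ 2θ^2/π^2` on `|θ| ≤ π`; multiplied by `1/(2ε^2)` at `θ = εu` it yields the
        -- rate `1/π^2`.
        have hc := Real.cos_le_one_sub_mul_cos_sq hu
        have hD := le_edge_coefficient hε h3.le h4.le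
        calc 1 / Real.pi ^ 2 * u ^ 2 = 1 / (2 * ε ^ 2) * (2 / Real.pi ^ 2 * (ε * u) ^ 2) := by
              field_simp
          _ ≤ _ := mul_le_mul hD (by linarith) (by positivity)
              (le_trans (by positivity) hD)

end

/-! ### Convergence of the rescaled contour integrals -/

section

open Complex

theorem continuous_edgeCircle (ε : ℝ) : Continuous (edgeCircle ε) := by
  unfold edgeCircle; fun_prop

theorem continuous_edgeIntegrand (ε : ℝ) (n : ℕ) (x : ℝ) : Continuous (edgeIntegrand ε n x) := by
  unfold edgeIntegrand; fun_prop

theorem edgeCircle_mem {ε : ℝ} (hε : 0 ≤ ε) (u : ℝ) :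
    edgeCircle ε u ∈ Metric.closedBall (0 : ℂ) (1 / 2) := by
  rw [edgeCircle_eq_circleMap, mem_closedBall_zero_iff, norm_circleMap_zero,
    abs_of_pos (by positivity)]
  have : Real.exp (-ε) ≤ 1 := Real.exp_le_one_iff.mpr (by linarith)
  linarith

theorem edgeIntegral_eq_integral_indicator (g : ℂ → ℂ) {ε : ℝ} (hε : 0 < ε) (n : ℕ) (x : ℝ) :
    edgeIntegral g ε n x = 1 / (2 * Real.pi) * ∫ u, (Set.Ioc (-(Real.pi / ε)) (Real.pi / ε)).indicator
      (fun u => edgeIntegrand ε n x u * g (edgeCircle ε u)) u := by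
  have h : 0 < Real.pi / ε := by positivity
  rw [edgeIntegral, intervalIntegral.integral_of_le (by linarith),
    integral_indicator measurableSet_Ioc]

/-- The Gaussian bound for the truncated integrand at the soft edge. -/
theorem eventually_norm_indicator_le (μ : ℝ) {g : ℂ → ℂ}
    (hg : ContinuousOn g (Metric.closedBall 0 (1 / 2))) :
    ∃ c : ℝ, 0 ≤ c ∧ ∀ᶠ ε : ℝ in 𝓝[>] 0, ∀ N j : ℕ, 2 * N * ε ^ 3 = 1 → j ≤ N → ∀ u : ℝ,
      ‖(Set.Ioc (-(Real.pi / ε)) (Real.pi / ε)).indicator (fun u =>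
        edgeIntegrand ε (N - j) (2 / ε ^ 3 + 2 * μ / ε) u * g (edgeCircle ε u)) u‖ ≤
        c * Real.exp (-(ε * j)) * Real.exp (-(1 / Real.pi ^ 2 * u ^ 2)) := by
  obtain ⟨c, hc, hev⟩ := eventually_norm_edgeIntegrand_le μ
  obtain ⟨M, hM⟩ := (isCompact_closedBall (0 : ℂ) (1 / 2)).exists_bound_of_continuousOn hg
  have hM0 : 0 ≤ M := (norm_nonneg _).trans (hM 0 (by simp))
  refine ⟨c * M, by positivity, ?_⟩
  filter_upwards [hev, self_mem_nhdsWithin] with ε h hε N j hN hj u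
  have hε : 0 < ε := hε
  by_cases hu : u ∈ Set.Ioc (-(Real.pi / ε)) (Real.pi / ε)
  · rw [Set.indicator_of_mem hu, norm_mul]
    have hu' : |ε * u| ≤ Real.pi := by
      rw [abs_mul, abs_of_pos hε, mul_comm, ← le_div_iff₀ hε]
      exact abs_le.mpr ⟨hu.1.le, hu.2⟩
    calc _ ≤ (c * Real.exp (-(ε * j)) * Real.exp (-(1 / Real.pi ^ 2 * u ^ 2))) * M :=
          mul_le_mul (h N j hN hj u hu') (hM _ (edgeCircle_mem hε.le u)) (norm_nonneg _)
            (by positivity)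
      _ = _ := by ring
  · rw [Set.indicator_of_notMem hu, norm_zero]
    positivity

theorem integrable_exp_neg_sq_div :
    Integrable fun u : ℝ => Real.exp (-(1 / Real.pi ^ 2 * u ^ 2)) := by
  simpa only [neg_mul] using integrable_exp_neg_mul_sq (b := 1 / Real.pi ^ 2) (by positivity)

/-- The exponential bound for the rescaled contour integral at the soft edge. -/
theorem eventually_norm_edgeIntegral_le (μ : ℝ) {g : ℂ → ℂ}
    (hg : ContinuousOn g (Metric.closedBall 0 (1 / 2))) :
    ∃ c : ℝ, 0 ≤ c ∧ ∀ᶠ ε : ℝ in 𝓝[>] 0, ∀ N j : ℕ, 2 * N * ε ^ 3 = 1 → j ≤ N →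
      ‖edgeIntegral g ε (N - j) (2 / ε ^ 3 + 2 * μ / ε)‖ ≤ c * Real.exp (-(ε * j)) := by
  obtain ⟨c, hc, hev⟩ := eventually_norm_indicator_le μ hg
  have hI : 0 ≤ ∫ u : ℝ, Real.exp (-(1 / Real.pi ^ 2 * u ^ 2)) :=
    integral_nonneg fun u => (Real.exp_pos _).le
  refine ⟨1 / (2 * Real.pi) * (c * ∫ u : ℝ, Real.exp (-(1 / Real.pi ^ 2 * u ^ 2))),
    by positivity, ?_⟩
  filter_upwards [hev, self_mem_nhdsWithin] with ε h hε N j hN hj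
  rw [edgeIntegral_eq_integral_indicator g hε, norm_mul]
  have h1 : ‖(1 / (2 * Real.pi) : ℂ)‖ = 1 / (2 * Real.pi) := by
    simp [abs_of_pos Real.pi_pos]
  have h2 := norm_integral_le_of_norm_le (integrable_exp_neg_sq_div.const_mul
    (c * Real.exp (-(ε * j)))) (ae_of_all _ (h N j hN hj))
  rw [integral_const_mul] at h2
  rw [h1]
  calc _ ≤ 1 / (2 * Real.pi) * (c * Real.exp (-(ε * j)) *
        ∫ u : ℝ, Real.exp (-(1 / Real.pi ^ 2 * u ^ 2))) :=
        mul_le_mul_of_nonneg_left h2 (by positivity)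
    _ = _ := by ring

/-- The rescaled contour integral at the soft edge converges to the Airy integral. -/
theorem tendsto_edgeIntegral {g : ℂ → ℂ} (hg : ContinuousOn g (Metric.closedBall 0 (1 / 2)))
    {ι : Type*} {l : Filter ι} [l.IsCountablyGenerated] {ε : ι → ℝ} {N j : ι → ℕ} {μ σ : ℝ}
    (hε : Tendsto ε l (𝓝[>] 0)) (hN : ∀ᶠ i in l, 2 * N i * ε i ^ 3 = 1)
    (hj : ∀ᶠ i in l, j i ≤ N i) (hσ : Tendsto (fun i => 2 * ε i * j i) l (𝓝 σ)) :
    Tendsto (fun i => edgeIntegral g (ε i) (N i - j i) (2 / ε i ^ 3 + 2 * μ / ε i)) l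
      (𝓝 (1 / (2 * Real.pi) *
        ∫ u : ℝ, exp ((1 + u * I) ^ 3 / 3 - (μ + σ : ℝ) * (1 + u * I)) * g (1 / 2))) := by
  obtain ⟨c, hc, hev⟩ := eventually_norm_indicator_le μ hg
  have hε0 : ∀ᶠ i in l, 0 < ε i := hε self_mem_nhdsWithin
  have hε' : Tendsto ε l (𝓝 0) := hε.mono_right nhdsWithin_le_nhds
  have hlim : Tendsto (fun i => ∫ u, (Set.Ioc (-(Real.pi / ε i)) (Real.pi / ε i)).indicator
      (fun u => edgeIntegrand (ε i) (N i - j i) (2 / ε i ^ 3 + 2 * μ / ε i) u *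
        g (edgeCircle (ε i) u)) u) l
      (𝓝 (∫ u : ℝ, exp ((1 + u * I) ^ 3 / 3 - (μ + σ : ℝ) * (1 + u * I)) * g (1 / 2))) := by
    refine tendsto_integral_filter_of_dominated_convergence
      (fun u => c * Real.exp (-(1 / Real.pi ^ 2 * u ^ 2))) ?_ ?_
      (integrable_exp_neg_sq_div.const_mul c) (ae_of_all _ fun u => ?_)
    · filter_upwards [hε0] with i hi
      refine AEStronglyMeasurable.indicator ?_ measurableSet_Ioc
      refine ((continuous_edgeIntegrand _ _ _).mul ?_).aestronglyMeasurable
      exact hg.comp_continuous (continuous_edgeCircle _) (edgeCircle_mem hi.le)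
    · filter_upwards [hε hev, hN, hj, hε0] with i hi hNi hji hi0
      refine ae_of_all _ fun u => (hi (N i) (j i) hNi hji u).trans ?_
      refine mul_le_mul_of_nonneg_right (mul_le_of_le_one_right hc ?_) (Real.exp_pos _).le
      rw [Real.exp_le_one_iff, neg_nonpos]
      positivity
    · have h1 := tendsto_edgeIntegrand (μ := μ) hε hN hj hσ u
      have h2 : Tendsto (fun i => g (edgeCircle (ε i) u)) l (𝓝 (g (1 / 2))) := by
        have hw : Tendsto (fun i => edgeCircle (ε i) u) l
            (𝓝[Metric.closedBall 0 (1 / 2)] (1 / 2)) := by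
          refine tendsto_nhdsWithin_iff.mpr ⟨?_, hε0.mono fun i hi => edgeCircle_mem hi.le u⟩
          have hcont : Continuous fun ε : ℝ => edgeCircle ε u := by unfold edgeCircle; fun_prop
          have := (hcont.tendsto 0).comp hε'
          simpa [edgeCircle, Function.comp_def] using this
        exact (hg (1 / 2) (by simp)).tendsto.comp hw
      refine (h1.mul h2).congr' ?_
      -- For fixed `u` the truncation `|u| < π/ε` eventually holds, so the indicator disappears in
      -- the limit.
      have h3 : Tendsto (fun i => ε i * |u|) l (𝓝 0) := by simpa using hε'.mul_const |u|
      filter_upwards [hε0, h3.eventually_lt_const Real.pi_pos] with i hi hui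
      rw [Set.indicator_of_mem]
      have : |u| < Real.pi / ε i := by rw [lt_div_iff₀ hi]; linarith
      exact ⟨(abs_lt.mp this).1, (abs_lt.mp this).2.le⟩
  refine (hlim.const_mul (1 / (2 * Real.pi) : ℂ)).congr' ?_
  filter_upwards [hε0] with i hi
  exact (edgeIntegral_eq_integral_indicator g hi _ _).symm

end

/-! ### The Airy function and its kernel -/

section

open Complex

/-- The point `1 + i t` of the contour of the Airy integral. -/
noncomputable def airyPoint (t : ℝ) : ℂ := 1 + t * I

theorem continuous_airyPoint : Continuous airyPoint := by unfold airyPoint; fun_prop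

/-- The Airy integral with an additional power of the integration variable. -/
noncomputable def airyMoment (k : ℕ) (x : ℝ) : ℂ :=
  1 / (2 * Real.pi) * ∫ t : ℝ, airyPoint t ^ k * exp (airyPoint t ^ 3 / 3 - x * airyPoint t)

/-- On `Re z = 1` the real part of `z^3/3 - xz` is `-t^2 + 1/3 - x`, which gives Gaussian decay in
`t` and the factor `e^{-x}`. -/
theorem norm_airyIntegrand (k : ℕ) (x t : ℝ) :
    ‖airyPoint t ^ k * exp (airyPoint t ^ 3 / 3 - x * airyPoint t)‖ =
      ‖airyPoint t‖ ^ k * Real.exp (-t ^ 2) * Real.exp (1 / 3 - x) := by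
  rw [norm_mul, norm_pow, norm_exp, mul_assoc, ← Real.exp_add]
  congr 2
  have : airyPoint t ^ 3 / 3 - x * airyPoint t =
      ((-t ^ 2 + (1 / 3 - x) : ℝ) : ℂ) + ((t - t ^ 3 / 3 - x * t : ℝ) : ℂ) * I := by
    rw [airyPoint]
    push_cast
    linear_combination ((t : ℂ) ^ 2 + (t : ℂ) ^ 3 / 3 * I) * I_sq
  rw [this, add_re, ofReal_re, re_ofReal_mul, I_re, mul_zero, add_zero]

theorem integrable_airyBound (k : ℕ) :
    Integrable fun t : ℝ => ‖airyPoint t‖ ^ k * Real.exp (-t ^ 2) := by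
  have h0 : Integrable fun t : ℝ => Real.exp (-t ^ 2) := by
    simpa using integrable_exp_neg_mul_sq (b := 1) one_pos
  have h1 : Integrable fun t : ℝ => t ^ (2 * k) * Real.exp (-t ^ 2) := by
    have := integrable_rpow_mul_exp_neg_mul_sq (b := 1) one_pos (s := ((2 * k : ℕ) : ℝ))
      (by have : (0 : ℝ) ≤ ((2 * k : ℕ) : ℝ) := Nat.cast_nonneg _
          linarith)
    simpa only [Real.rpow_natCast, neg_one_mul] using this
  refine ((h0.add h1).const_mul (2 ^ k)).mono' ?_ (ae_of_all _ fun t => ?_)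
  · exact ((continuous_airyPoint.norm.pow k).mul (by fun_prop)).aestronglyMeasurable
  · rw [Real.norm_of_nonneg (by positivity), Pi.add_apply, ← one_add_mul, ← mul_assoc]
    refine mul_le_mul_of_nonneg_right ?_ (Real.exp_pos _).le
    have hn : ‖airyPoint t‖ ^ 2 = 1 + t ^ 2 := by
      rw [airyPoint, Complex.sq_norm, ← ofReal_one, normSq_add_mul_I]; ring
    have h1 : 1 ≤ ‖airyPoint t‖ := by
      by_contra h
      nlinarith [norm_nonneg (airyPoint t), sq_nonneg t]
    calc ‖airyPoint t‖ ^ k ≤ ‖airyPoint t‖ ^ (2 * k) := pow_le_pow_right₀ h1 (by omega)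
      _ = (1 + t ^ 2) ^ k := by rw [pow_mul, hn]
      _ ≤ 2 ^ (k - 1) * (1 ^ k + (t ^ 2) ^ k) := add_pow_le zero_le_one (sq_nonneg t) k
      _ ≤ 2 ^ k * (1 + t ^ (2 * k)) := by
        rw [one_pow, ← pow_mul]
        refine mul_le_mul_of_nonneg_right (pow_le_pow_right₀ one_le_two (by omega)) ?_
        rw [pow_mul]; positivity

theorem continuous_airyIntegrand (k : ℕ) (x : ℝ) :
    Continuous fun t => airyPoint t ^ k * exp (airyPoint t ^ 3 / 3 - x * airyPoint t) := by
  have := continuous_airyPoint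
  fun_prop

theorem integrable_airyIntegrand (k : ℕ) (x : ℝ) :
    Integrable fun t => airyPoint t ^ k * exp (airyPoint t ^ 3 / 3 - x * airyPoint t) :=
  ((integrable_airyBound k).mul_const (Real.exp (1 / 3 - x))).mono'
    (continuous_airyIntegrand k x).aestronglyMeasurable
    (ae_of_all _ fun t => (norm_airyIntegrand k x t).le)

/-- The factor `e^{-x}` is far from the true decay of the Airy function, but it suffices for
integrability on half-lines and for boundary terms to vanish at infinity. -/
theorem exists_norm_airyMoment_le (k : ℕ) :
    ∃ c : ℝ, 0 ≤ c ∧ ∀ x, ‖airyMoment k x‖ ≤ c * Real.exp (-x) := by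
  have hI : 0 ≤ ∫ t : ℝ, ‖airyPoint t‖ ^ k * Real.exp (-t ^ 2) :=
    integral_nonneg fun t => by positivity
  refine ⟨‖(1 / (2 * Real.pi) : ℂ)‖ * ((∫ t : ℝ, ‖airyPoint t‖ ^ k * Real.exp (-t ^ 2)) *
    Real.exp (1 / 3)), by positivity, fun x => ?_⟩
  rw [airyMoment, norm_mul, mul_assoc]
  refine mul_le_mul_of_nonneg_left ?_ (norm_nonneg _)
  refine (norm_integral_le_integral_norm _).trans_eq ?_
  simp_rw [norm_airyIntegrand]
  rw [integral_mul_const, mul_assoc, ← Real.exp_add, sub_eq_add_neg]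

theorem hasDerivAt_airyMoment (k : ℕ) (x : ℝ) :
    HasDerivAt (airyMoment k) (-airyMoment (k + 1) x) x := by
  have h := hasDerivAt_integral_of_dominated_loc_of_deriv_le (μ := volume) (𝕜 := ℝ)
    (F := fun (x : ℝ) t => airyPoint t ^ k * exp (airyPoint t ^ 3 / 3 - x * airyPoint t))
    (F' := fun (x : ℝ) t => -(airyPoint t ^ (k + 1) * exp (airyPoint t ^ 3 / 3 - x * airyPoint t)))
    (x₀ := x) (s := Metric.ball x 1)
    (bound := fun t => ‖airyPoint t‖ ^ (k + 1) * Real.exp (-t ^ 2) * Real.exp (1 / 3 - x + 1))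
    (Metric.ball_mem_nhds x one_pos)
    (Eventually.of_forall fun y => (continuous_airyIntegrand k y).aestronglyMeasurable)
    (integrable_airyIntegrand k x)
    (continuous_airyIntegrand (k + 1) x).neg.aestronglyMeasurable
    (ae_of_all _ fun t y hy => ?_)
    ((integrable_airyBound (k + 1)).mul_const _)
    (ae_of_all _ fun t y _ => ?_)
  · have := h.2.const_mul (1 / (2 * Real.pi) : ℂ)
    rw [integral_neg, mul_neg] at this
    exact this
  · rw [norm_neg, norm_airyIntegrand]
    refine mul_le_mul_of_nonneg_left (Real.exp_le_exp.mpr ?_) (by positivity)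
    have := (abs_lt.mp (Metric.mem_ball.mp hy)).1
    linarith
  · have h1 : HasDerivAt (fun y : ℝ => airyPoint t ^ 3 / 3 - (y : ℂ) * airyPoint t)
        (-airyPoint t) y := by
      simpa using ((hasDerivAt_id y).ofReal_comp.mul_const (airyPoint t)).const_sub
        (airyPoint t ^ 3 / 3)
    refine (h1.cexp.const_mul (airyPoint t ^ k)).congr_deriv ?_
    ring

/-- The Airy equation. -/
theorem airyMoment_two (x : ℝ) : airyMoment 2 x = x * airyMoment 0 x := by
  -- The derivative of `exp(z^3/3 - xz)` along the contour is `i(z^2 - x)` times itself, and its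
  -- integral vanishes.
  have hd : ∀ t : ℝ, HasDerivAt (fun t => exp (airyPoint t ^ 3 / 3 - x * airyPoint t))
      (I * (airyPoint t ^ 2 * exp (airyPoint t ^ 3 / 3 - x * airyPoint t)) -
        I * x * (airyPoint t ^ 0 * exp (airyPoint t ^ 3 / 3 - x * airyPoint t))) t := by
    intro t
    have h0 : HasDerivAt airyPoint I t :=
      (((hasDerivAt_id t).ofReal_comp.mul_const I).const_add 1).congr_deriv (by simp)
    refine ((((h0.pow 3).div_const 3).sub (h0.const_mul (x : ℂ))).cexp).congr_deriv ?_
    simp only [Pi.sub_apply, Pi.pow_apply]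
    push_cast
    ring
  have hi2 := (integrable_airyIntegrand 2 x).const_mul I
  have hi0 := (integrable_airyIntegrand 0 x).const_mul (I * x)
  have h := integral_eq_zero_of_hasDerivAt_of_integrable hd (hi2.sub hi0)
    (by simpa using integrable_airyIntegrand 0 x)
  rw [integral_sub hi2 hi0, integral_const_mul, integral_const_mul, mul_assoc I, ← mul_sub] at h
  have h2 := (mul_eq_zero.mp h).resolve_left I_ne_zero
  rw [airyMoment, airyMoment, sub_eq_zero.mp h2]
  ring

open scoped ComplexConjugate in
theorem conj_airyMoment (k : ℕ) (x : ℝ) : conj (airyMoment k x) = airyMoment k x := by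
  rw [airyMoment, map_mul, ← integral_conj, ← integral_neg_eq_self]
  have h2 : conj (2 : ℂ) = 2 := conj_ofNat 2
  have h3 : conj (3 : ℂ) = 3 := conj_ofNat 3
  congr 1
  · simp [h2]
  · refine integral_congr_ae (ae_of_all _ fun t => ?_)
    have h : conj (airyPoint (-t)) = airyPoint t := by simp [airyPoint]
    simp only [map_mul, map_pow, ← exp_conj, map_sub, map_div₀, h, conj_ofReal, h3]

theorem ofReal_airyAi (x : ℝ) : (airyAi x : ℂ) = airyMoment 0 x := by
  have h1 : (airyMoment 0 x).re = airyAi x := by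
    rw [airyMoment, airyAi, show (1 / (2 * Real.pi) : ℂ) = ((1 / (2 * Real.pi) : ℝ) : ℂ) by simp,
      re_ofReal_mul]
    simp [airyPoint]
  rw [← h1]
  exact conj_eq_iff_re.mp (conj_airyMoment 0 x)

/-- The derivative of the Airy function, as a contour integral. -/
noncomputable def airyDeriv (x : ℝ) : ℝ := -(airyMoment 1 x).re

theorem hasDerivAt_re {f : ℝ → ℂ} {f' : ℂ} {x : ℝ} (h : HasDerivAt f f' x) :
    HasDerivAt (fun y => (f y).re) f'.re x :=
  reCLM.hasFDerivAt.comp_hasDerivAt x h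

theorem airyAi_eq_re (x : ℝ) : airyAi x = (airyMoment 0 x).re := by rw [← ofReal_airyAi, ofReal_re]

theorem hasDerivAt_airyAi (x : ℝ) : HasDerivAt airyAi (airyDeriv x) x := by
  have h := hasDerivAt_re (hasDerivAt_airyMoment 0 x)
  simp_rw [← airyAi_eq_re] at h
  simpa [airyDeriv] using h

theorem hasDerivAt_airyDeriv (x : ℝ) : HasDerivAt airyDeriv (x * airyAi x) x := by
  have h := (hasDerivAt_re (hasDerivAt_airyMoment 1 x)).neg
  refine h.congr_deriv ?_
  rw [neg_re, neg_neg, airyMoment_two, ← ofReal_airyAi, ← ofReal_mul, ofReal_re]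

theorem exists_abs_airyAi_le : ∃ c : ℝ, 0 ≤ c ∧ ∀ x, |airyAi x| ≤ c * Real.exp (-x) := by
  obtain ⟨c, hc, h⟩ := exists_norm_airyMoment_le 0
  exact ⟨c, hc, fun x => by rw [airyAi_eq_re]; exact (abs_re_le_norm _).trans (h x)⟩

theorem tendsto_exp_bound {f : ℝ → ℝ} {c : ℝ} (h : ∀ x, |f x| ≤ c * Real.exp (-x)) (x : ℝ) :
    Tendsto (fun s => f (x + s)) atTop (𝓝 0) := by
  refine squeeze_zero_norm (a := fun s => c * Real.exp (-(x + s))) (fun s => h _) ?_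
  have : Tendsto (fun s => Real.exp (-(x + s))) atTop (𝓝 0) :=
    Real.tendsto_exp_neg_atTop_nhds_zero.comp (tendsto_atTop_add_const_left _ x tendsto_id)
  simpa using this.const_mul c

theorem tendsto_airyAi_add (x : ℝ) : Tendsto (fun s => airyAi (x + s)) atTop (𝓝 0) := by
  obtain ⟨c, _, h⟩ := exists_abs_airyAi_le
  exact tendsto_exp_bound h x

theorem tendsto_airyDeriv_add (x : ℝ) : Tendsto (fun s => airyDeriv (x + s)) atTop (𝓝 0) := by
  obtain ⟨c, _, h⟩ := exists_norm_airyMoment_le 1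
  refine tendsto_exp_bound (c := c) (fun x => ?_) x
  rw [airyDeriv, abs_neg]
  exact (abs_re_le_norm _).trans (h x)

theorem continuous_airyAi : Continuous airyAi :=
  continuous_iff_continuousAt.mpr fun x => (hasDerivAt_airyAi x).continuousAt

theorem integrableOn_airyAi_mul_airyAi (x y : ℝ) :
    IntegrableOn (fun s => airyAi (x + s) * airyAi (y + s)) (Set.Ioi 0) := by
  obtain ⟨c, hc, h⟩ := exists_abs_airyAi_le
  have hi := (integrableOn_exp_mul_Ioi (a := -2) (by norm_num) 0).const_mul
    (c * Real.exp (-x) * (c * Real.exp (-y)))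
  refine Integrable.mono' hi ?_ (ae_of_all _ fun s => ?_)
  · exact ((continuous_airyAi.comp (by fun_prop)).mul
      (continuous_airyAi.comp (by fun_prop))).aestronglyMeasurable
  · rw [norm_mul]
    refine (mul_le_mul (h (x + s)) (h (y + s)) (abs_nonneg _) (by positivity)).trans_eq ?_
    rw [neg_add, neg_add, Real.exp_add, Real.exp_add, show -2 * s = -s + -s by ring, Real.exp_add]
    ring

/-- The Airy kernel as an integral of a product of shifted Airy functions. -/
theorem integral_airyAi_mul_airyAi (x y : ℝ) :
    ∫ s in Set.Ioi (0 : ℝ), airyAi (x + s) * airyAi (y + s) = airyKernel x y := by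
  have hA : ∀ x s, HasDerivAt (fun s => airyAi (x + s)) (airyDeriv (x + s)) s := fun x s =>
    (hasDerivAt_airyAi (x + s)).comp_const_add x s
  have hD : ∀ x s, HasDerivAt (fun s => airyDeriv (x + s)) ((x + s) * airyAi (x + s)) s :=
    fun x s => (hasDerivAt_airyDeriv (x + s)).comp_const_add x s
  have hder : deriv airyAi = airyDeriv := funext fun x => (hasDerivAt_airyAi x).deriv
  have hint := integrableOn_airyAi_mul_airyAi x y
  rw [airyKernel, hder]
  split_ifs with hxy
  · subst hxy
    -- By `Ai'' = x Ai`, the derivative of `x Ai^2 - Ai'^2` is `Ai^2`.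
    have hF : ∀ s ∈ Set.Ici (0 : ℝ), HasDerivAt
        (fun s => (x + s) * airyAi (x + s) ^ 2 - airyDeriv (x + s) ^ 2)
        (airyAi (x + s) * airyAi (x + s)) s := by
      intro s _
      have hl : HasDerivAt (fun s => x + s) 1 s := (hasDerivAt_id s).const_add x
      refine ((hl.mul ((hA x s).pow 2)).sub ((hD x s).pow 2)).congr_deriv ?_
      simp only [Pi.pow_apply]
      push_cast
      ring
    have hlim : Tendsto (fun s => (x + s) * airyAi (x + s) ^ 2 - airyDeriv (x + s) ^ 2) atTop
        (𝓝 0) := by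
      have h1 : Tendsto (fun s => (x + s) * airyAi (x + s)) atTop (𝓝 0) := by
        obtain ⟨c, hc, h⟩ := exists_abs_airyAi_le
        have h2 : Tendsto (fun s => c * ((x + s) ^ 1 * Real.exp (-(x + s)))) atTop (𝓝 0) := by
          have := (Real.tendsto_pow_mul_exp_neg_atTop_nhds_zero 1).comp
            (tendsto_atTop_add_const_left _ x tendsto_id)
          simpa using this.const_mul c
        refine squeeze_zero_norm' ?_ h2
        filter_upwards [eventually_ge_atTop (-x)] with s hs
        rw [norm_mul, Real.norm_of_nonneg (by linarith)]
        refine (mul_le_mul_of_nonneg_left (h (x + s)) (by linarith)).trans_eq ?_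
        ring
      have h3 := (h1.mul (tendsto_airyAi_add x)).sub ((tendsto_airyDeriv_add x).pow 2)
      norm_num at h3
      refine h3.congr fun s => ?_
      ring
    rw [integral_Ioi_of_hasDerivAt_of_tendsto' hF hint hlim]
    simp
  · have hne : x - y ≠ 0 := sub_ne_zero.mpr hxy
    -- The Wronskian of two shifted Airy functions has derivative `(x - y)` times their product, the
    -- shift `s` cancelling.
    have hF : ∀ s ∈ Set.Ici (0 : ℝ), HasDerivAt
        (fun s => (airyDeriv (x + s) * airyAi (y + s) - airyAi (x + s) * airyDeriv (y + s)) /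
          (x - y)) (airyAi (x + s) * airyAi (y + s)) s := by
      intro s _
      refine (((((hD x s).mul (hA y s)).sub ((hA x s).mul (hD y s)))).div_const
        (x - y)).congr_deriv ?_
      field_simp
      ring
    have hlim : Tendsto (fun s => (airyDeriv (x + s) * airyAi (y + s) -
        airyAi (x + s) * airyDeriv (y + s)) / (x - y)) atTop (𝓝 0) := by
      have := (((tendsto_airyDeriv_add x).mul (tendsto_airyAi_add y)).sub
        ((tendsto_airyAi_add x).mul (tendsto_airyDeriv_add y))).div_const (x - y)
      simpa using this
    rw [integral_Ioi_of_hasDerivAt_of_tendsto' hF hint hlim]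
    simp only [add_zero]
    field_simp
    ring

end

/-! ### Riemann sums and exponentially weighted tails -/

/-- A sum over a grid as the integral of a step function. -/
theorem integral_floor_div_eq_sum {h : ℝ} (hh : 0 < h) (a : ℕ → ℂ) (M : ℕ)
    (ha : ∀ k, M ≤ k → a k = 0) :
    ∫ s in Set.Ioi (0 : ℝ), a ⌊s / h⌋₊ = ∑ k ∈ Finset.range M, h * a k := by
  have e : ∀ s ∈ Set.Ici (0 : ℝ), a ⌊s / h⌋₊ = ∑ k ∈ Finset.range M,
      (Set.Ico (h * k) (h * (k + 1))).indicator (fun _ => a k) s := by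
    intro s hs
    have hs : 0 ≤ s := hs
    have hmem : ∀ k : ℕ, s ∈ Set.Ico (h * k) (h * (k + 1)) ↔ ⌊s / h⌋₊ = k := by
      intro k
      rw [Nat.floor_eq_iff (by positivity), le_div_iff₀ hh, div_lt_iff₀ hh, Set.mem_Ico,
        mul_comm h, mul_comm h]
    rw [Finset.sum_eq_single ⌊s / h⌋₊]
    · rw [Set.indicator_of_mem ((hmem _).mpr rfl)]
    · intro k _ hk
      exact Set.indicator_of_notMem (fun hs => hk ((hmem k).mp hs).symm) _
    · intro hk
      rw [Set.indicator_of_mem ((hmem _).mpr rfl)]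
      exact ha _ (by simpa using hk)
  have hi : ∀ k : ℕ, Integrable ((Set.Ico (h * k) (h * (k + 1))).indicator (fun _ => a k))
      (volume.restrict (Set.Ici (0 : ℝ))) := fun k =>
    ((integrable_indicator_iff measurableSet_Ico).mpr
      (integrableOn_const (by simp))).integrableOn
  rw [← integral_Ici_eq_integral_Ioi, setIntegral_congr_fun measurableSet_Ici e,
    integral_finsetSum _ fun k _ => hi k]
  refine Finset.sum_congr rfl fun k _ => ?_
  rw [setIntegral_indicator measurableSet_Ico, Set.inter_eq_right.mpr, setIntegral_const]
  · rw [measureReal_def, Real.volume_Ico, ENNReal.toReal_ofReal (by nlinarith), Complex.real_smul]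
    congr 2
    ring
  · intro s hs
    exact le_trans (by positivity) hs.1

section RiemannSum

variable {h : ℕ → ℝ} {B : ℕ → ℕ → ℂ} {M : ℕ → ℕ} {c : ℝ}

/-- Convergence of Riemann sums with an exponentially decaying summand. -/
theorem tendsto_riemannSum {G : ℝ → ℂ} (hh : Tendsto h atTop (𝓝[>] 0)) (hc : 0 ≤ c)
    (hB : ∀ᶠ N in atTop, ∀ k, ‖B N k‖ ≤ c * Real.exp (-(h N * k)))
    (hM : ∀ N k, M N ≤ k → B N k = 0)
    (hlim : ∀ s : ℝ, 0 < s → Tendsto (fun N => B N ⌊s / h N⌋₊) atTop (𝓝 (G s))) :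
    Tendsto (fun N => ∑ k ∈ Finset.range (M N), h N * B N k) atTop
      (𝓝 (∫ s in Set.Ioi (0 : ℝ), G s)) := by
  have hpos : ∀ᶠ N in atTop, 0 < h N := hh self_mem_nhdsWithin
  have hle : ∀ᶠ N in atTop, h N < 1 :=
    (hh.mono_right nhdsWithin_le_nhds).eventually_lt_const one_pos
  have key : Tendsto (fun N => ∫ s in Set.Ioi (0 : ℝ), B N ⌊s / h N⌋₊) atTop
      (𝓝 (∫ s in Set.Ioi (0 : ℝ), G s)) := by
    -- Rounding down loses at most one mesh, `h⌊s/h⌋ ≥ s - h ≥ s - 1`, hence the factor `e` in the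
    -- majorant.
    refine tendsto_integral_filter_of_dominated_convergence
      (fun s => c * Real.exp 1 * Real.exp (-1 * s)) ?_ ?_
      ((integrableOn_exp_mul_Ioi (by norm_num) 0).const_mul _) ?_
    · refine Eventually.of_forall fun N => Measurable.aestronglyMeasurable ?_
      exact (measurable_from_top (f := B N)).comp (Nat.measurable_floor.comp (by fun_prop))
    · filter_upwards [hB, hpos, hle] with N hN hN0 hN1
      refine ae_of_all _ fun s => (hN _).trans ?_
      rw [mul_assoc, ← Real.exp_add]
      refine mul_le_mul_of_nonneg_left (Real.exp_le_exp.mpr ?_) hc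
      have := (Nat.lt_floor_add_one (s / h N)).le
      rw [div_le_iff₀ hN0] at this
      linarith
    · exact (ae_restrict_mem measurableSet_Ioi).mono fun s hs => hlim s hs
  refine key.congr' ?_
  filter_upwards [hpos] with N hN
  exact integral_floor_div_eq_sum hN _ _ (hM N)

/-- The geometric series gives `h / (1 - e^{-h})`, and `1 - e^{-h} ≥ h/(1 + h) ≥ h/2`. The bound is
uniform in the mesh and in the index set, as the dominated sum over `d` requires. -/
theorem sum_mul_exp_neg_le_two {h : ℝ} (hh : 0 < h) (h1 : h ≤ 1) (s : Finset ℕ) :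
    ∑ k ∈ s, h * Real.exp (-(h * k)) ≤ 2 := by
  have hlt : Real.exp (-h) < 1 := Real.exp_lt_one_iff.mpr (by linarith)
  have e : ∀ k : ℕ, Real.exp (-(h * k)) = Real.exp (-h) ^ k := fun k => by
    rw [← Real.exp_nat_mul]; congr 1; ring
  simp_rw [e, ← Finset.mul_sum]
  have hs := (summable_geometric_of_lt_one (Real.exp_pos _).le hlt).sum_le_tsum s
    (fun k _ => by positivity)
  rw [tsum_geometric_of_lt_one (Real.exp_pos _).le hlt] at hs
  have h2 : Real.exp (-h) * (1 + h) ≤ 1 := by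
    have := Real.add_one_le_exp h
    rw [Real.exp_neg, inv_mul_le_one₀ (Real.exp_pos _)]
    linarith
  have h3 : h / 2 ≤ 1 - Real.exp (-h) := by nlinarith [Real.exp_pos (-h)]
  calc h * ∑ k ∈ s, Real.exp (-h) ^ k ≤ h * (1 - Real.exp (-h))⁻¹ :=
        mul_le_mul_of_nonneg_left hs hh.le
    _ ≤ h * (h / 2)⁻¹ := by gcongr
    _ = 2 := by field_simp

/-- Tails of converging Riemann sums, averaged with exponential weights. -/
theorem tendsto_exp_weighted_tails {A κ : ℂ} (hh : Tendsto h atTop (𝓝[>] 0))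
    (hB : ∀ᶠ N in atTop, ∀ k, ‖B N k‖ ≤ c * Real.exp (-(h N * k)))
    (hMtop : Tendsto M atTop atTop)
    (hA : Tendsto (fun N => ∑ k ∈ Finset.range (M N), h N * B N k) atTop (𝓝 A)) :
    Tendsto (fun N => ∑ d ∈ Finset.range (M N), κ ^ d / d ! *
      ∑ k ∈ Finset.Ico d (M N), h N * B N k) atTop (𝓝 (Complex.exp κ * A)) := by
  have hpos : ∀ᶠ N in atTop, 0 < h N := hh self_mem_nhdsWithin
  have h0 : Tendsto h atTop (𝓝 0) := hh.mono_right nhdsWithin_le_nhds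
  have hle : ∀ᶠ N in atTop, h N < 1 := h0.eventually_lt_const one_pos
  have hterm : ∀ k, Tendsto (fun N => h N * B N k) atTop (𝓝 0) := by
    intro k
    refine squeeze_zero_norm' (a := fun N => h N * |c|) ?_ (by simpa using h0.mul_const |c|)
    filter_upwards [hB, hpos] with N hN hN0
    rw [norm_mul, Complex.norm_real, Real.norm_of_nonneg hN0.le]
    refine mul_le_mul_of_nonneg_left ((hN k).trans ?_) hN0.le
    refine (mul_le_mul_of_nonneg_right (le_abs_self c) (Real.exp_pos _).le).trans ?_
    refine mul_le_of_le_one_right (abs_nonneg c) (Real.exp_le_one_iff.mpr ?_)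
    rw [neg_nonpos]; positivity
  have htail : ∀ d, Tendsto (fun N => ∑ k ∈ Finset.Ico d (M N), h N * B N k) atTop (𝓝 A) := by
    intro d
    -- For fixed `d` the finitely many omitted terms are each of size `O(h)`, so every tail has the
    -- full limit `A`.
    have h1 := hA.sub (tendsto_finsetSum (Finset.range d) fun k _ => hterm k)
    rw [Finset.sum_const_zero, sub_zero] at h1
    refine h1.congr' ?_
    filter_upwards [hMtop.eventually_ge_atTop d] with N hN
    rw [Finset.sum_Ico_eq_sub _ hN]
  have hexp : Complex.exp κ * A = ∑' d : ℕ, κ ^ d / d ! * A := by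
    rw [tsum_mul_right, Complex.exp_eq_exp_ℂ, NormedSpace.exp_eq_tsum_div]
  rw [hexp]
  have hsum : Summable fun d : ℕ => ‖κ‖ ^ d / d ! * (|c| * 2) :=
    (Real.summable_pow_div_factorial ‖κ‖).mul_right _
  have key := tendsto_tsum_of_dominated_convergence (𝓕 := atTop)
    (f := fun N d => if d ∈ Finset.range (M N) then κ ^ d / d ! *
      ∑ k ∈ Finset.Ico d (M N), h N * B N k else 0) (g := fun d => κ ^ d / d ! * A) hsum ?_ ?_
  · refine key.congr fun N => ?_
    rw [tsum_eq_sum (s := Finset.range (M N)) fun d hd => if_neg hd]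
    exact Finset.sum_congr rfl fun d hd => if_pos hd
  · intro d
    refine ((htail d).const_mul (κ ^ d / d !)).congr' ?_
    filter_upwards [hMtop.eventually_gt_atTop d] with N hN
    rw [if_pos (Finset.mem_range.mpr hN)]
  · filter_upwards [hB, hpos, hle] with N hN hN0 hN1 d
    have hn : ‖κ ^ d / (d ! : ℂ)‖ = ‖κ‖ ^ d / d ! := by simp
    split_ifs
    · rw [norm_mul, hn]
      refine mul_le_mul_of_nonneg_left ?_ (by positivity)
      refine (norm_sum_le _ _).trans ?_
      calc ∑ k ∈ Finset.Ico d (M N), ‖(h N : ℂ) * B N k‖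
          ≤ ∑ k ∈ Finset.Ico d (M N), |c| * (h N * Real.exp (-(h N * k))) := by
            refine Finset.sum_le_sum fun k _ => ?_
            rw [norm_mul, Complex.norm_real, Real.norm_of_nonneg hN0.le, mul_left_comm]
            refine mul_le_mul_of_nonneg_left ((hN k).trans ?_) hN0.le
            exact mul_le_mul_of_nonneg_right (le_abs_self c) (Real.exp_pos _).le
        _ ≤ |c| * 2 := by
            rw [← Finset.mul_sum]
            exact mul_le_mul_of_nonneg_left (sum_mul_exp_neg_le_two hN0 hN1.le _) (abs_nonneg c)
    · rw [norm_zero]; positivity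

theorem tendsto_mul_floor_div (hh : Tendsto h atTop (𝓝[>] 0)) {s : ℝ} (hs : 0 < s) :
    Tendsto (fun N => h N * (⌊s / h N⌋₊ : ℝ)) atTop (𝓝 s) := by
  have hpos : ∀ᶠ N in atTop, 0 < h N := hh self_mem_nhdsWithin
  have h0 : Tendsto h atTop (𝓝 0) := hh.mono_right nhdsWithin_le_nhds
  have h1 : Tendsto (fun N => s - h N) atTop (𝓝 s) := by simpa using h0.const_sub s
  refine tendsto_of_tendsto_of_tendsto_of_le_of_le' h1 tendsto_const_nhds ?_ ?_
  · filter_upwards [hpos] with N hN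
    have := (Nat.lt_floor_add_one (s / h N)).le
    rw [div_le_iff₀ hN] at this
    linarith
  · filter_upwards [hpos] with N hN
    have := Nat.floor_le (div_nonneg hs.le hN.le)
    rw [le_div_iff₀ hN] at this
    linarith

end RiemannSum

/-! ### Scaling at the soft edge -/

/-- The scale `(2 N) ^ (-1 / 3)` of the contour at the soft edge. -/
noncomputable def edgeScale (N : ℕ) : ℝ := ((2 * N : ℝ) ^ (1 / 3 : ℝ))⁻¹

/-- The spectral parameter at the soft edge. -/
noncomputable def edgePoint (N : ℕ) (μ : ℝ) : ℝ := 2 / edgeScale N ^ 3 + 2 * μ / edgeScale N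

theorem edgeScale_pos {N : ℕ} (hN : 0 < N) : 0 < edgeScale N := by
  have : (0 : ℝ) < N := by exact_mod_cast hN
  unfold edgeScale; positivity

theorem two_mul_mul_edgeScale_pow {N : ℕ} (hN : 0 < N) : 2 * N * edgeScale N ^ 3 = 1 := by
  have h : (0 : ℝ) < 2 * N := by have : (0 : ℝ) < N := by exact_mod_cast hN
                                 linarith
  rw [edgeScale, inv_pow, ← Real.rpow_natCast, ← Real.rpow_mul h.le]
  norm_num
  field_simp

theorem tendsto_edgeScale : Tendsto edgeScale atTop (𝓝[>] 0) := by
  refine tendsto_inv_atTop_nhdsGT_zero.comp ?_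
  exact (tendsto_rpow_atTop (by norm_num)).comp
    (tendsto_natCast_atTop_atTop.const_mul_atTop two_pos)

theorem two_rpow_mul_rpow {N : ℕ} :
    (2 : ℝ) ^ (4 / 3 : ℝ) * (N : ℝ) ^ (1 / 3 : ℝ) = 2 / edgeScale N := by
  rw [edgeScale, div_inv_eq_mul, Real.mul_rpow two_pos.le (Nat.cast_nonneg N), ← mul_assoc]
  congr 1
  rw [show (4 / 3 : ℝ) = 1 + 1 / 3 by norm_num, Real.rpow_add two_pos, Real.rpow_one]

theorem edgePoint_eq {N : ℕ} (hN : 0 < N) (μ : ℝ) :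
    4 * (N : ℝ) + (2 : ℝ) ^ (4 / 3 : ℝ) * μ * (N : ℝ) ^ (1 / 3 : ℝ) = edgePoint N μ := by
  have h1 := two_mul_mul_edgeScale_pow hN
  have h2 := edgeScale_pos hN
  rw [mul_right_comm, two_rpow_mul_rpow, edgePoint]
  field_simp
  linear_combination 2 * h1

/-- The quadratic in `N^{1/3}` inside the power factors into the two spectral parameters. The
scaling is thus the square root of the Laguerre weights, `(xy)^{α/2} e^{-(x+y)/2}`. -/
theorem softEdgeScaling_eq {N : ℕ} (hN : 0 < N) (α : ℕ) (μ ν : ℝ) :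
    softEdgeScaling α N ((2 : ℝ) ^ (4 / 3 : ℝ) * μ) ((2 : ℝ) ^ (4 / 3 : ℝ) * ν) =
      (edgePoint N μ * edgePoint N ν) ^ ((α : ℝ) / 2) *
        Real.exp (-(edgePoint N μ / 2) - edgePoint N ν / 2) := by
  have hN' : (0 : ℝ) ≤ N := Nat.cast_nonneg N
  have h4 : (N : ℝ) ^ (4 / 3 : ℝ) = ((N : ℝ) ^ (1 / 3 : ℝ)) ^ 4 := by
    rw [← Real.rpow_natCast, ← Real.rpow_mul hN']; norm_num
  have h3 : (N : ℝ) = ((N : ℝ) ^ (1 / 3 : ℝ)) ^ 3 := by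
    rw [← Real.rpow_natCast, ← Real.rpow_mul hN']; norm_num
  have h2 : (N : ℝ) ^ (2 / 3 : ℝ) = ((N : ℝ) ^ (1 / 3 : ℝ)) ^ 2 := by
    rw [← Real.rpow_natCast, ← Real.rpow_mul hN']; norm_num
  rw [softEdgeScaling, ← edgePoint_eq hN, ← edgePoint_eq hN, h4, h2]
  congr 2
  · set p := (N : ℝ) ^ (1 / 3 : ℝ)
    rw [h3]
    ring
  · ring

theorem tendsto_edgePoint_div (μ ν : ℝ) :
    Tendsto (fun N => edgePoint N μ / edgePoint N ν) atTop (𝓝 1) := by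
  have h0 : Tendsto edgeScale atTop (𝓝 0) := tendsto_edgeScale.mono_right nhdsWithin_le_nhds
  have h : ∀ μ : ℝ, Tendsto (fun N => 2 + 2 * μ * edgeScale N ^ 2) atTop (𝓝 2) := fun μ => by
    simpa using ((h0.pow 2).const_mul (2 * μ)).const_add 2
  have h1 := (h μ).div (h ν) two_ne_zero
  rw [div_self two_ne_zero] at h1
  refine h1.congr' ?_
  filter_upwards [eventually_gt_atTop 0] with N hN
  have hs := (edgeScale_pos hN).ne'
  have e : ∀ μ, edgePoint N μ = (2 + 2 * μ * edgeScale N ^ 2) / edgeScale N ^ 3 := fun μ => by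
    rw [edgePoint]; field_simp
  rw [Pi.div_apply, e, e, div_div_div_cancel_right₀ (pow_ne_zero 3 hs)]

theorem eventually_edgePoint_pos (μ : ℝ) : ∀ᶠ N in atTop, 0 < edgePoint N μ := by
  have h0 : Tendsto edgeScale atTop (𝓝 0) := tendsto_edgeScale.mono_right nhdsWithin_le_nhds
  have h : Tendsto (fun N => 2 + 2 * μ * edgeScale N ^ 2) atTop (𝓝 2) := by
    simpa using ((h0.pow 2).const_mul (2 * μ)).const_add 2
  filter_upwards [h.eventually_const_lt two_pos, eventually_gt_atTop 0] with N hN hN0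
  have hs := edgeScale_pos hN0
  have e : edgePoint N μ = (2 + 2 * μ * edgeScale N ^ 2) / edgeScale N ^ 3 := by
    rw [edgePoint]; field_simp
  rw [e]; positivity

/-- The ratio of Laguerre weights that is left over at the soft edge. -/
noncomputable def weightRatio (α N : ℕ) (μ ν : ℝ) : ℝ :=
  (edgePoint N μ * edgePoint N ν) ^ ((α : ℝ) / 2) / edgePoint N ν ^ α

theorem tendsto_weightRatio (α : ℕ) (μ ν : ℝ) :
    Tendsto (fun N => weightRatio α N μ ν) atTop (𝓝 1) := by
  have h := (tendsto_edgePoint_div μ ν).rpow_const (p := (α : ℝ) / 2) (Or.inl one_ne_zero)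
  rw [Real.one_rpow] at h
  refine h.congr' ?_
  filter_upwards [eventually_edgePoint_pos μ, eventually_edgePoint_pos ν] with N hμ hν
  have e : edgePoint N ν ^ α = (edgePoint N ν * edgePoint N ν) ^ ((α : ℝ) / 2) := by
    rw [← sq, ← Real.rpow_natCast _ 2, ← Real.rpow_mul hν.le, ← Real.rpow_natCast]
    congr 1
    push_cast
    ring
  rw [weightRatio, e, ← Real.div_rpow (by positivity) (by positivity),
    mul_div_mul_right _ _ hν.ne']

section Edge

variable (α : ℕ)

theorem continuousOn_pow_closedBall :
    ContinuousOn (fun t : ℂ => t ^ α) (Metric.closedBall 0 (1 / 2)) := by fun_prop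

theorem one_sub_ne_zero_of_mem_closedBall {t : ℂ} (ht : t ∈ Metric.closedBall (0 : ℂ) (1 / 2)) :
    1 - t ≠ 0 := by
  intro h
  rw [mem_closedBall_zero_iff, ← sub_eq_zero.mp h, norm_one] at ht
  norm_num at ht

theorem continuousOn_inv_one_sub_pow_closedBall :
    ContinuousOn (fun t : ℂ => ((1 - t) ^ α)⁻¹) (Metric.closedBall 0 (1 / 2)) :=
  ContinuousOn.inv₀ (by fun_prop) fun _ ht => pow_ne_zero α (one_sub_ne_zero_of_mem_closedBall ht)

theorem edgeCircle_ne_zero (ε u : ℝ) : edgeCircle ε u ≠ 0 :=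
  div_ne_zero (Complex.exp_ne_zero _) two_ne_zero

/-- The summands of the Laguerre kernel as products of rescaled contour integrals. -/
theorem laguerreTerm_eq_edgeIntegral {ε : ℝ} (hε : 0 < ε) (m : ℕ) (x y : ℝ) :
    (y : ℂ) ^ α * laguerreTerm (m + α) m x y = Complex.exp (x / 2 + y / 2) * ε ^ 2 *
      (edgeIntegral (fun t => t ^ α) ε (m + α) x *
        edgeIntegral (fun t => ((1 - t) ^ α)⁻¹) ε (m + α) y) := by
  -- Both factors are brought to the power `((1 - t)/t)^{m+α}`: the amplitude is `t^α` here, and `(1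
  -- - t)^{-α}` for the swapped polynomial in `h2`.
  have h1 := laguerrePoly_eval_eq_edgeIntegral hε x (m + α) m (fun t => t ^ α) (m + α) fun u => by
    have := edgeCircle_ne_zero ε u
    rw [div_pow, inv_pow, pow_add (edgeCircle ε u) m α]
    field_simp
  have h2 := laguerrePoly_eval_eq_edgeIntegral hε y m (m + α) (fun t => ((1 - t) ^ α)⁻¹) (m + α)
    fun u => by
      have := edgeCircle_ne_zero ε u
      have h3 := one_sub_ne_zero_of_mem_closedBall (edgeCircle_mem hε.le u)
      rw [div_pow, inv_pow, pow_add (1 - edgeCircle ε u) m α]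
      field_simp
  rw [laguerrePoly_swap, Polynomial.eval_mul, Polynomial.eval_pow, Polynomial.eval_X] at h2
  rw [Complex.exp_add, show Complex.exp (x / 2) * Complex.exp (y / 2) * (ε : ℂ) ^ 2 *
      (edgeIntegral (fun t => t ^ α) ε (m + α) x *
        edgeIntegral (fun t => ((1 - t) ^ α)⁻¹) ε (m + α) y) =
      (Complex.exp (x / 2) * (ε * edgeIntegral (fun t => t ^ α) ε (m + α) x)) *
      (Complex.exp (y / 2) * (ε * edgeIntegral (fun t => ((1 - t) ^ α)⁻¹) ε (m + α) y)) by ring,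
    ← h1, ← h2, laguerreTerm]
  ring

/-- The rescaled summand of the Laguerre kernel at the soft edge. -/
noncomputable def edgeSummand (μ ν : ℝ) (N k : ℕ) : ℂ :=
  if k < N - α + 1 then weightRatio α N μ ν *
    (edgeIntegral (fun t => t ^ α) (edgeScale N) (N - k) (edgePoint N μ) *
      edgeIntegral (fun t => ((1 - t) ^ α)⁻¹) (edgeScale N) (N - k) (edgePoint N ν)) else 0

/-- The prefactor is `2/ε` and the two contour integrals bring `ε^2`, leaving the mesh `2ε`; the
exponentials `e^{±(x+y)/2}` cancel exactly. -/
theorem scaling_mul_laguerreTerm (μ ν : ℝ) : ∀ᶠ N : ℕ in atTop, ∀ k < N - α + 1,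
    (((2 : ℝ) ^ (4 / 3 : ℝ) * (N : ℝ) ^ (1 / 3 : ℝ) *
      softEdgeScaling α N ((2 : ℝ) ^ (4 / 3 : ℝ) * μ) ((2 : ℝ) ^ (4 / 3 : ℝ) * ν) : ℝ) : ℂ) *
      laguerreTerm (N - k) (N - α - k) (edgePoint N μ) (edgePoint N ν) =
    ((2 * edgeScale N : ℝ) : ℂ) * edgeSummand α μ ν N k := by
  filter_upwards [eventually_ge_atTop (α + 1), eventually_edgePoint_pos ν] with N hN hν k hk
  have hN0 : 0 < N := by omega
  have hε := edgeScale_pos hN0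
  obtain ⟨m, hm⟩ : ∃ m, N - α - k = m := ⟨_, rfl⟩
  have hNk : N - k = m + α := by omega
  rw [edgeSummand, if_pos hk, hm, hNk, two_rpow_mul_rpow, softEdgeScaling_eq hN0]
  have h := laguerreTerm_eq_edgeIntegral α hε m (edgePoint N μ) (edgePoint N ν)
  have hy : (edgePoint N ν : ℂ) ^ α ≠ 0 := pow_ne_zero _ (by exact_mod_cast hν.ne')
  have hεc : (edgeScale N : ℂ) ≠ 0 := by exact_mod_cast hε.ne'
  apply mul_left_cancel₀ hy
  rw [mul_left_comm, h, weightRatio]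
  have hexp : ((Real.exp (-(edgePoint N μ / 2) - edgePoint N ν / 2) : ℝ) : ℂ) *
      Complex.exp (edgePoint N μ / 2 + edgePoint N ν / 2) = 1 := by
    rw [Complex.ofReal_exp, ← Complex.exp_add]
    push_cast
    rw [show (-((edgePoint N μ : ℂ) / 2) - edgePoint N ν / 2 +
      (edgePoint N μ / 2 + edgePoint N ν / 2)) = 0 by ring, Complex.exp_zero]
  rw [Complex.ofReal_mul, Complex.ofReal_mul, Complex.ofReal_div (_ ^ _), Complex.ofReal_pow]
  generalize ((Real.exp (-(edgePoint N μ / 2) - edgePoint N ν / 2) : ℝ) : ℂ) = E at hexp ⊢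
  generalize Complex.exp (edgePoint N μ / 2 + edgePoint N ν / 2) = F at hexp ⊢
  generalize edgeIntegral (fun t => t ^ α) (edgeScale N) (m + α) (edgePoint N μ) = I₁
  generalize edgeIntegral (fun t => ((1 - t) ^ α)⁻¹) (edgeScale N) (m + α) (edgePoint N ν) = I₂
  generalize (((edgePoint N μ * edgePoint N ν) ^ ((α : ℝ) / 2) : ℝ) : ℂ) = W
  push_cast
  field_simp
  linear_combination (W * I₁ * I₂) * hexp

/-- Each contour integral contributes `e^{-εk}`; the product decays at exactly the rate of the mesh
`2ε`. -/
theorem exists_norm_edgeSummand_le (μ ν : ℝ) : ∃ c : ℝ, 0 ≤ c ∧ ∀ᶠ N : ℕ in atTop, ∀ k,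
    ‖edgeSummand α μ ν N k‖ ≤ c * Real.exp (-(2 * edgeScale N * k)) := by
  obtain ⟨c₁, hc₁, h₁⟩ := eventually_norm_edgeIntegral_le μ (continuousOn_pow_closedBall α)
  obtain ⟨c₂, hc₂, h₂⟩ := eventually_norm_edgeIntegral_le ν
    (continuousOn_inv_one_sub_pow_closedBall α)
  refine ⟨2 * (c₁ * c₂), by positivity, ?_⟩
  have hR : ∀ᶠ N in atTop, ‖weightRatio α N μ ν‖ < 2 :=
    (tendsto_weightRatio α μ ν).norm.eventually_lt_const (by norm_num)
  filter_upwards [tendsto_edgeScale h₁, tendsto_edgeScale h₂, hR, eventually_ge_atTop (α + 1)]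
    with N h₁ h₂ hR hN k
  have h1 := two_mul_mul_edgeScale_pow (N := N) (by omega)
  rw [edgeSummand]
  split_ifs with hk
  · have hkN : k ≤ N := by omega
    rw [norm_mul, norm_mul, Complex.norm_real]
    have e : Real.exp (-(2 * edgeScale N * k)) =
        Real.exp (-(edgeScale N * k)) * Real.exp (-(edgeScale N * k)) := by
      rw [← Real.exp_add]; congr 1; ring
    rw [e, mul_assoc, mul_mul_mul_comm]
    exact mul_le_mul hR.le (mul_le_mul (h₁ N k h1 hkN) (h₂ N k h1 hkN) (norm_nonneg _)
      (by positivity)) (by positivity) zero_le_two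
  · rw [norm_zero]; positivity

theorem tendsto_two_mul_edgeScale : Tendsto (fun N => 2 * edgeScale N) atTop (𝓝[>] 0) := by
  have h0 : Tendsto edgeScale atTop (𝓝 0) := tendsto_edgeScale.mono_right nhdsWithin_le_nhds
  refine tendsto_nhdsWithin_iff.mpr ⟨by simpa using h0.const_mul 2, ?_⟩
  filter_upwards [eventually_gt_atTop 0] with N hN
  have := edgeScale_pos hN
  exact Set.mem_Ioi.mpr (by positivity)

theorem tendsto_edgeSummand (μ ν : ℝ) {s : ℝ} (hs : 0 < s) :
    Tendsto (fun N => edgeSummand α μ ν N ⌊s / (2 * edgeScale N)⌋₊) atTop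
      (𝓝 ((airyAi (μ + s) * airyAi (ν + s) : ℝ) : ℂ)) := by
  have hσ := tendsto_mul_floor_div tendsto_two_mul_edgeScale hs
  have hN : ∀ᶠ N : ℕ in atTop, 2 * N * edgeScale N ^ 3 = 1 :=
    (eventually_gt_atTop 0).mono fun N hN => two_mul_mul_edgeScale_pow hN
  -- At fixed `s` the index is of order `ε^{-1}`, far below `N - α`, which is of order `ε^{-3}`.
  have hk : ∀ᶠ N : ℕ in atTop, ⌊s / (2 * edgeScale N)⌋₊ < N - α + 1 := by
    have h0 : Tendsto edgeScale atTop (𝓝 0) := tendsto_edgeScale.mono_right nhdsWithin_le_nhds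
    have h1 : Tendsto (fun N => (s + 2 * α * edgeScale N) * edgeScale N ^ 2) atTop (𝓝 0) := by
      simpa using ((h0.const_mul (2 * (α : ℝ))).const_add s).mul (h0.pow 2)
    filter_upwards [h1.eventually_lt_const one_pos, hN, eventually_ge_atTop (α + 1)]
      with N h1 hN hNα
    have hε := edgeScale_pos (N := N) (by omega)
    have h2 : s / (2 * edgeScale N) ≤ ((N - α : ℕ) : ℝ) := by
      rw [Nat.cast_sub (by omega), div_le_iff₀ (by positivity)]
      have h3 : (s + 2 * α * edgeScale N) * edgeScale N ^ 2 ≤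
          (2 * N * edgeScale N) * edgeScale N ^ 2 := by
        rw [show 2 * (N : ℝ) * edgeScale N * edgeScale N ^ 2 = 2 * N * edgeScale N ^ 3 by ring, hN]
        exact h1.le
      have h4 := le_of_mul_le_mul_right h3 (by positivity)
      linarith
    have := Nat.floor_le_of_le h2
    omega
  have hk' : ∀ᶠ N : ℕ in atTop, ⌊s / (2 * edgeScale N)⌋₊ ≤ N := by
    filter_upwards [hk, eventually_ge_atTop (α + 1)] with N h1 h2
    omega
  have h1 := tendsto_edgeIntegral (μ := μ) (continuousOn_pow_closedBall α) tendsto_edgeScale hN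
    hk' hσ
  have h2 := tendsto_edgeIntegral (μ := ν) (continuousOn_inv_one_sub_pow_closedBall α)
    tendsto_edgeScale hN hk' hσ
  have hA : ∀ μ : ℝ, (airyAi (μ + s) : ℂ) = 1 / (2 * Real.pi) * ∫ u : ℝ,
      Complex.exp ((1 + u * Complex.I) ^ 3 / 3 - (μ + s : ℝ) * (1 + u * Complex.I)) := fun μ => by
    rw [ofReal_airyAi, airyMoment]
    simp [airyPoint]
  rw [integral_mul_const, ← mul_assoc, ← hA] at h1 h2
  have h3 := ((Complex.continuous_ofReal.tendsto 1).comp (tendsto_weightRatio α μ ν)).mul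
    (h1.mul h2)
  -- The amplitudes at the saddle `t = 1/2` are `2^{-α}` and `2^α`, so no power of two remains.
  rw [mul_mul_mul_comm, show (1 - 1 / 2 : ℂ) = 1 / 2 by norm_num,
    mul_inv_cancel₀ (pow_ne_zero α (by norm_num)), mul_one, Complex.ofReal_one, one_mul,
    ← Complex.ofReal_mul] at h3
  refine h3.congr' ?_
  filter_upwards [hk] with N hkN
  rw [edgeSummand, if_pos hkN]
  rfl

end Edge

/-! ### The soft edge limit -/

/-- The subtraction `N - α` is truncated at zero for `N < α`, which does not affect the limit. -/
theorem theorem5p1 (Q : Measure ℝ) [IsProbabilityMeasure Q] (b : ℝ)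
    (hmean : ∫ x, x ∂Q = 0)
    (hvar : variance (fun x : ℝ => x) Q = 1 / 2)
    (hfour_int : Integrable (fun x : ℝ => x ^ 4) Q)
    (hfour : ∫ x, x ^ 4 ∂Q = b)
    (α : ℕ) (μ ν : ℝ) :
    Tendsto
      (fun N : ℕ =>
        (((2 : ℝ) ^ (4 / 3 : ℝ) * (N : ℝ) ^ (1 / 3 : ℝ) *
            softEdgeScaling α N ((2 : ℝ) ^ (4 / 3 : ℝ) * μ) ((2 : ℝ) ^ (4 / 3 : ℝ) * ν) : ℝ) : ℂ) *
          (secondOrderCorrelation Q N (N - α)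
              ((4 * (N : ℝ) + (2 : ℝ) ^ (4 / 3 : ℝ) * μ * (N : ℝ) ^ (1 / 3 : ℝ) : ℝ) : ℂ)
              ((4 * (N : ℝ) + (2 : ℝ) ^ (4 / 3 : ℝ) * ν * (N : ℝ) ^ (1 / 3 : ℝ) : ℝ) : ℂ) /
            (((N)! : ℂ) * ((N - α)! : ℂ))))
      atTop
      (𝓝 ((Real.exp (2 * (b - 3 / 4)) * airyKernel μ ν : ℝ) : ℂ)) := by
  obtain ⟨c, hc, hbound⟩ := exists_norm_edgeSummand_le α μ ν
  have hzero : ∀ N k, N - α + 1 ≤ k → edgeSummand α μ ν N k = 0 := fun N k hk => by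
    rw [edgeSummand, if_neg (by omega)]
  have hA := tendsto_riemannSum tendsto_two_mul_edgeScale hc hbound hzero
    fun s hs => tendsto_edgeSummand α μ ν hs
  rw [integral_complex_ofReal, integral_airyAi_mul_airyAi] at hA
  have hMtop : Tendsto (fun N : ℕ => N - α + 1) atTop atTop :=
    (tendsto_add_atTop_nat 1).comp (tendsto_sub_atTop_nat α)
  -- The fourth moment enters only through these weights `κ^d / d!`, which sum to the factor
  -- `exp(b*)`.
  have h := tendsto_exp_weighted_tails (κ := ((2 * (b - 3 / 4) : ℝ) : ℂ))
    tendsto_two_mul_edgeScale hbound hMtop hA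
  rw [← Complex.ofReal_exp, ← Complex.ofReal_mul] at h
  refine h.congr' ?_
  filter_upwards [scaling_mul_laguerreTerm α μ ν, eventually_gt_atTop 0] with N hN hN0
  rw [edgePoint_eq hN0, edgePoint_eq hN0,
    secondOrderCorrelation_div_factorial hmean hvar hfour_int hfour (Nat.sub_le N α),
    Finset.mul_sum]
  refine Finset.sum_congr rfl fun d _ => ?_
  rw [mul_left_comm]
  congr 1
  rw [Finset.mul_sum]
  refine Finset.sum_congr rfl fun k hk => ?_
  exact (hN k (Finset.mem_Ico.mp hk).2).symm
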